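/- **Setting.** $M\ge 1$ agents, numbered $1,\dots,M$, play the same stochastic linear bandit for $T>\max\{M,2\}$ synchronous time steps. The action set is a fixed, nonempty, finite $\mathcal D\subseteq\{x\in\mathbb R^d:\|x\|_2\le 1\}$ with $d\ge 3$; the unknown parameter $\theta^*\in\mathbb R^d$ has $\|\theta^*\|_2\le 1$. If agent $i$ pulls $x_{t,i}\in\mathcal D$ at time $t$, it observes $\langle x_{t,i},\theta^*\rangle+\eta_{t,i}(x_{t,i})$, where the random functions $\eta_{t,i}:\mathcal D\to[-1,1]$ are independent over $(t,i)$ and $\mathbb E\,\eta_{t,i}(x)=0$ for every $x$ (in particular $\eta_{t,i}$ may not depend on $x$). The regret is $REG(T)=\sum_{t=1}^T\sum_{i=1}^M\big(\max_{x\in\mathcal D}\langle x,\theta^*\rangle-\langle x_{t,i},\theta^*\rangle\big)$. In the P2P network there is no server; agents send messages to each other, and in one time step an agent can receive a message from at most one other agent. The communication cost is the number of integers and real numbers sent in the $T$ steps from an agent to a different agent. **The protocol DELB in the P2P network.** Agent $1$ also acts as the server. Let $A_1=\mathcal D$. For $l=1,2,\dots$, until time $T$: 1. All agents compute, by a common rule,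 the same probability distribution $\pi_l$ on $A_l$ whose support has at most $48\,d\log\log d$ elements and for which $\max_{x\in A_l}x^\top V(\pi_l)^{-1}x\le 2d$, where $V(\pi)=\sum_x\pi(x)xx^\top$ (if $A_l$ does not span $\mathbb R^d$, inverses are taken within the span of $A_l$). Put $m_l(x)=\lceil 600\cdot 4^l d^2\pi_l(x)\ln(MT)\rceil$ and $p_l=\lceil\sum_x m_l(x)/M\rceil$. Going through the support by decreasing $m_l(x)$ and through the agents in order, agent $1$ assigns $m_l(x)$ pulls to each $x$, filling each agent up with $p_l$ pulls before it turns to the next one. 2. In $M-1$ time steps agent $1$ sends to the agents $2,\dots,M$, one per step, the list of pairs (index of an arm in the support, number of pulls) which is assigned to it. 3. In $p_l$ time steps every agent makes its assigned pulls. 4. In $M-1$ time steps the agents $2,\dots,M$, one per step, send to agent $1$ the average reward of each of their assigned arms. 5. Agent $1$ computes the overall average $\mu_l(x)$ of the $m_l(x)$ rewards of each $x$ in the support and $\hat\theta_l=V_l^{-1}\sum_x m_l(x)\mu_l(x)x$ with $V_l=\sum_x m_l(x)xx^\top$. In $M-1$ time steps it sends $\hat\theta_l$ ($d$ real numbers)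 to the agents $2,\dots,M$, one per step. 6. All agents set $A_{l+1}=\{x\in A_l:\max_{b\in A_l}\langle\hat\theta_l,b-x\rangle\le 2^{-l+1}\}$. In every time step in which an agent has no assigned pull to make (in particular in steps 2, 4, 5), it pulls an arbitrary arm of $\mathcal D$; the rewards of these pulls are not used. **Theorem.** A rule for choosing $\pi_l$ as in step 1 exists, and there is a universal constant $C$ such that for all $d,M,T,\mathcal D,\theta^*$ and noise as above, for every such rule, every way of breaking ties in the order of the support and every choice of the arbitrary arms, DELB in the P2P network satisfies $$\mathbb E[REG(T)]\le C\left(d\sqrt{MT\log T}+M^2\log T\right),$$ its expected communication cost is at most $$C\,(Md+d\log\log d)\log T,$$ and if $T>M^3\log M$, then the expected regret is near-optimal: $\mathbb E[REG(T)]\le C\,d\sqrt{MT\log T}$. -/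

import Mathlib

open MeasureTheory ProbabilityTheory

namespace DELB

/-- The Euclidean space `ℝ^d`. -/
abbrev Vec (d : ℕ) := EuclideanSpace ℝ (Fin d)

/-! ### Peer-to-peer protocols for a linear bandit -/

/-- A message between two agents: a list of pairs of integers (index of an arm, number of pulls of
it), a list of real numbers (average rewards), or a vector of `ℝ^d`. -/
inductive Message (d : ℕ) where
  | assign (w : List (ℕ × ℕ))
  | report (r : List ℝ)
  | param (v : Vec d)

/-- Number of packets of a message, where one packet holds one integer or one real number. -/
def Message.size {d : ℕ} : Message d → ℕ
  | .assign w => 2 * w.length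
  | .report r => r.length
  | .param _ => d

/-- A synchronous protocol of `M` agents in a peer-to-peer network (there is no server). In every
time step agent `i`, as a function of its own state only, pulls an arm (`none` stands for an
arbitrary arm), sends messages to other agents, and listens to at most one agent. It then
updates its state from its own reward and from the message it has received, if any. -/
structure P2PProtocol (d M : ℕ) where
  State : Type
  init : Fin M → State
  act : Fin M → State → Option (Vec d)
  send : Fin M → State → (receiver : Fin M) → Option (Message d)
  listen : Fin M → State → Option (Fin M)
  update : Fin M → State → (reward : ℝ) → (inbox : Option (Message d)) → State

namespace P2PProtocol

variable {d M : ℕ} (P : P2PProtocol d M)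

/-- The states of the agents at the beginning of time step `t` (time starts at `0`), for the mean
reward parameter `θ`, a realization `η` of the noise (`η t i x` is the noise of the reward of
agent `i` at time `t` if it pulls `x`), and the arm `free t i` which agent `i` pulls at time `t`
if the protocol tells it to pull an arbitrary arm. -/
noncomputable def state (θ : Vec d) (η : ℕ → Fin M → Vec d → ℝ) (free : ℕ → Fin M → Vec d) :
    ℕ → Fin M → P.State
  | 0 => P.init
  | t + 1 => fun i =>
      let s := state θ η free t
      let x := (P.act i (s i)).getD (free t i)
      P.update i (s i) (inner ℝ x θ + η t i x)
        ((P.listen i (s i)).bind fun j => if j = i then none else P.send j (s j) i)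

/-- The arm `x_{t,i}` pulled by agent `i` at time `t`. -/
noncomputable def action (θ : Vec d) (η : ℕ → Fin M → Vec d → ℝ) (free : ℕ → Fin M → Vec d)
    (t : ℕ) (i : Fin M) : Vec d :=
  (P.act i (P.state θ η free t i)).getD (free t i)

/-- `REG(T)`: the total regret of all agents in `T` time steps. -/
noncomputable def regret (D : Finset (Vec d)) (hD : D.Nonempty) (θ : Vec d)
    (η : ℕ → Fin M → Vec d → ℝ) (free : ℕ → Fin M → Vec d) (T : ℕ) : ℝ :=
  ∑ t ∈ Finset.range T, ∑ i : Fin M,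
    (D.sup' hD (fun x => inner ℝ x θ) - inner ℝ (P.action θ η free t i) θ)

/-- Communication cost: the number of packets (integers or real numbers) which are sent from an
agent to a different agent in `T` time steps. -/
noncomputable def commCost (θ : Vec d) (η : ℕ → Fin M → Vec d → ℝ) (free : ℕ → Fin M → Vec d)
    (T : ℕ) : ℕ :=
  ∑ t ∈ Finset.range T, ∑ i : Fin M, ∑ j : Fin M,
    if j = i then 0 else ((P.send i (P.state θ η free t i) j).map Message.size).getD 0

end P2PProtocol

/-! ### Approximate G-optimal designs -/

/-- A finitely supported weight: arms `arm 0, …, arm (size - 1)`, the `c`-th of weight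
`weight c`. -/
structure Design (d : ℕ) where
  size : ℕ
  arm : ℕ → Vec d
  weight : ℕ → ℝ

/-- The operator `u ↦ (∑_c w_c x_c x_cᵀ) u`, where `x_c` is the `c`-th arm. -/
noncomputable def Design.moment {d : ℕ} (δ : Design d) (w : ℕ → ℝ) (u : Vec d) : Vec d :=
  ∑ c ∈ Finset.range δ.size, (w c * inner ℝ (δ.arm c) u) • δ.arm c

/-- `⌈600 * 4^l * d^2 * π_l(x) * ln (M T)⌉`: number of pulls of the `c`-th arm in phase `l`. -/
noncomputable def pulls {d : ℕ} (M T l : ℕ) (δ : Design d) (c : ℕ) : ℕ :=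
  ⌈600 * 4 ^ l * (d : ℝ) ^ 2 * δ.weight c * Real.log (M * T)⌉₊

/-- `δ` is an admissible design in phase `l` with active set `A`: a distribution over `A` with
support of size at most `48 d log log d` and `g(π) = max_{x ∈ A} xᵀ V(π)⁻¹ x ≤ 2 d`, listed by
decreasing number of pulls. If `A` does not span `ℝ^d`, then the inverse is taken within the
span of `A`: `V(π)⁻¹ x` is the vector `u` of the span with `V(π) u = x`. -/
structure IsDesign {d : ℕ} (M T l : ℕ) (A : Finset (Vec d)) (δ : Design d) : Prop where
  arm_mem : ∀ c < δ.size, δ.arm c ∈ A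
  arm_inj : ∀ c < δ.size, ∀ c' < δ.size, δ.arm c = δ.arm c' → c = c'
  weight_pos : ∀ c < δ.size, 0 < δ.weight c
  weight_sum : ∑ c ∈ Finset.range δ.size, δ.weight c = 1
  size_le : (δ.size : ℝ) ≤ 48 * d * Real.log (Real.log d)
  g_le : ∀ x ∈ A, ∃ u ∈ Submodule.span ℝ (A : Set (Vec d)),
    δ.moment δ.weight u = x ∧ inner ℝ x u ≤ 2 * (d : ℝ)
  sorted : ∀ c c' : ℕ, c ≤ c' → c' < δ.size → pulls M T l δ c' ≤ pulls M T l δ c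

/-- A rule by which all agents find the design of phase `l` from the active set `A`. -/
abbrev DesignRule (d : ℕ) := ℕ → Finset (Vec d) → Design d

/-- The rule returns an admissible design for every nonempty active set. -/
def DesignRule.Valid {d : ℕ} (M T : ℕ) (R : DesignRule d) : Prop :=
  ∀ (l : ℕ) (A : Finset (Vec d)), A.Nonempty → IsDesign M T l A (R l A)

/-! ### Assignment of the pulls to the agents -/

/-- The sequence of pulls which is described by a list of pairs (index of arm, number). -/
def expand (w : List (ℕ × ℕ)) : List ℕ :=
  w.flatMap fun q => List.replicate q.2 q.1

/-- Pulls per agent: `⌈(∑_{c < n} m_c) / M⌉`. -/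
def perAgent (M n : ℕ) (m : ℕ → ℕ) : ℕ :=
  (∑ c ∈ Finset.range n, m c) ⌈/⌉ M

/-- The pulls assigned to the agent number `j` (counting from `0`): arms are gone through in order,
and each agent is filled up with `perAgent M n m` pulls before the next one is used. -/
def block (M n : ℕ) (m : ℕ → ℕ) (j : ℕ) : List ℕ :=
  ((expand ((List.range n).map fun c => (c, m c))).drop (j * perAgent M n m)).take
    (perAgent M n m)

/-- The same as a list of pairs (index of arm, positive number of pulls). -/
def assignment (M n : ℕ) (m : ℕ → ℕ) (j : ℕ) : List (ℕ × ℕ) :=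
  ((List.range n).filter fun c => 0 < (block M n m j).count c).map
    fun c => (c, (block M n m j).count c)

/-! ### The protocol -/

/-- Local state of an agent: current phase, time steps since the start of the phase, active
set, own assignment in this phase, sums of rewards for each arm of the design (for the agent `0`,
which plays the server, also those reported to it), and the last estimate received. -/
structure LocalState (d : ℕ) where
  phase : ℕ
  step : ℕ
  active : Finset (Vec d)
  work : List (ℕ × ℕ)
  sums : ℕ → ℝ
  est : Vec d

open Classical in
/-- The least squares estimate `V_l⁻¹ X` with `V_l = ∑_c m_c x_c x_cᵀ` and `X = ∑_c m_c μ_c x_c`, where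
`μ_c` is the average reward of the `c`-th arm. The inverse is taken within the span of `A`. -/
noncomputable def estimate {d : ℕ} (A : Finset (Vec d)) (δ : Design d) (m : ℕ → ℕ)
    (sums : ℕ → ℝ) : Vec d :=
  let X : Vec d := ∑ c ∈ Finset.range δ.size, ((m c : ℝ) * (sums c / m c)) • δ.arm c
  if h : ∃ v ∈ Submodule.span ℝ (A : Set (Vec d)), δ.moment (fun c => (m c : ℝ)) v = X then
    h.choose
  else 0

open Classical in
/-- `A_{l+1} = {x ∈ A_l : max_{b ∈ A_l} ⟨v, b - x⟩ ≤ 2^(-l+1)}`. -/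
noncomputable def eliminate {d : ℕ} (l : ℕ) (A : Finset (Vec d)) (v : Vec d) :
    Finset (Vec d) :=
  A.filter fun x => ∀ b ∈ A, inner ℝ v (b - x) ≤ 2 * (1 / 2 : ℝ) ^ l

section Protocol

variable {d : ℕ} (M T : ℕ) (R : DesignRule d)

namespace LocalState

variable (s : LocalState d)

/-- The design of the current phase, computed locally. -/
def design : Design d := R s.phase s.active

/-- Number of pulls of each arm in the current phase. -/
noncomputable def num (c : ℕ) : ℕ := pulls M T s.phase (s.design R) c

/-- Length of the pulling stage of the current phase. -/
noncomputable def pullSteps : ℕ := perAgent M (s.design R).size (s.num M T R)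

/-- The assignment of agent number `j` in the current phase. -/
noncomputable def assigned (j : ℕ) : List (ℕ × ℕ) :=
  assignment M (s.design R).size (s.num M T R) j

/-- The estimate computed by agent `0`. -/
noncomputable def fit : Vec d := estimate s.active (s.design R) (s.num M T R) s.sums

/-- Agent `0` knows its own assignment, the others use the one which they have received. -/
noncomputable def ownWork (i : ℕ) : List (ℕ × ℕ) :=
  if i = 0 then s.assigned M T R 0 else s.work

/-- Index of the arm to pull in the current time step; `none` outside of the pulling stage, and when
all assigned pulls have been made. -/
noncomputable def target (i : ℕ) : Option ℕ :=
  if M - 1 ≤ s.step ∧ s.step < (M - 1) + s.pullSteps M T R then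
    (expand (s.ownWork M T R i))[s.step - (M - 1)]?
  else none

/-- The message which agent `i` sends to agent `j` in the current time step. A phase has four
stages: agent `0` sends the assignments, one agent per time step (`M - 1` steps); all agents
pull their assigned arms; the agents `1, …, M - 1` send their average rewards to agent `0`, one
agent per time step (`M - 1` steps); agent `0` sends the estimate, one agent per time step
(`M - 1` steps). -/
noncomputable def outbox (i j : ℕ) : Option (Message d) :=
  let p := s.pullSteps M T R
  if i = 0 ∧ s.step < M - 1 ∧ j = s.step + 1 then
    some (.assign (s.assigned M T R j))
  else if j = 0 ∧ 0 < i ∧ i ≤ M - 1 ∧ s.step + 1 = (M - 1) + p + i then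
    some (.report (s.work.map fun q => s.sums q.1 / q.2))
  else if i = 0 ∧ 0 < j ∧ j ≤ M - 1 ∧ s.step + 1 = 2 * (M - 1) + p + j then
    some (.param (s.fit M T R))
  else none

/-- The number of the agent to which agent `i` listens: agent `0` listens to the agent whose turn it is
to report, and the others listen to agent `0`. -/
noncomputable def source (i : ℕ) : Option ℕ :=
  if i = 0 then
    (if (M - 1) + s.pullSteps M T R ≤ s.step then
      some (s.step + 1 - ((M - 1) + s.pullSteps M T R)) else none)
  else some 0

/-- The sums of rewards, after the averages `r` of the agent with assignment `w` were received. -/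
noncomputable def addReport (w : List (ℕ × ℕ)) (r : List ℝ) : LocalState d :=
  { s with sums := fun c => s.sums c +
      ((w.zip r).map fun q => if q.1.1 = c then (q.1.2 : ℝ) * q.2 else 0).sum }

/-- Recording of the reward `y` of an assigned pull. -/
noncomputable def addReward (i : ℕ) (y : ℝ) : LocalState d :=
  match s.target M T R i with
  | some c => { s with sums := Function.update s.sums c (s.sums c + y) }
  | none => s

/-- Processing of a received message. -/
noncomputable def receive : Option (Message d) → LocalState d
  | some (.assign w) => { s with work := w }
  | some (.report r) =>
      s.addReport (s.assigned M T R (s.step + 1 - ((M - 1) + s.pullSteps M T R))) r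
  | some (.param v) => { s with est := v }
  | none => s

/-- The clock: when the four stages of the phase are over, the agent eliminates arms and starts
the next phase. -/
noncomputable def advance (i : ℕ) : LocalState d :=
  if s.step + 1 < 3 * (M - 1) + s.pullSteps M T R then { s with step := s.step + 1 }
  else
    { phase := s.phase + 1
      step := 0
      active := eliminate s.phase s.active (if i = 0 then s.fit M T R else s.est)
      work := []
      sums := 0
      est := 0 }

end LocalState

/-- The protocol DELB (Distributed Elimination for Linear Bandits) in a peer-to-peer network of
`M` agents, for the time horizon `T`, the action set `D`, and a rule for choosing designs. -/
noncomputable def delb (D : Finset (Vec d)) : P2PProtocol d M where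
  State := LocalState d
  init _ := { phase := 1, step := 0, active := D, work := [], sums := 0, est := 0 }
  act i s := (s.target M T R i).map (s.design R).arm
  send i s j := s.outbox M T R i j
  listen i s := (s.source M T R i).bind fun j => if h : j < M then some ⟨j, h⟩ else none
  update i s y inbox := ((s.addReward M T R i y).receive M T R inbox).advance M T R i

end Protocol

end DELB

/-! Designs. Among all choices of 2d points of A with repetition, take one that maximizes the
determinant of the moment matrix, computed in orthonormal coordinates of span A. Exchanging one
point for another cannot raise the determinant. Summing this over the points and using that the
leverages add up to the dimension gives leverage at most 1 for every x in A (`exists_tuple`). The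
uniform weight on these points has g at most 2d and at most 2d atoms, which is within 48 d log log d
for d ≥ 3. So the exact optimum over multisets replaces any approximation algorithm.

Dynamics. Every agent ends a phase with the same vector, so the local states are views of one common
state `Cur` (phase, step, active set). The recursion `cur` for it is driven by the noise of assigned
pulls alone; rewards of arbitrary pulls are never recorded, so the arbitrary arms cannot influence
it. `state_eq` identifies the protocol with this recursion, after which messages no longer matter
except for their size.

Concentration. For a fixed state at the start of a phase the pulls are fixed, and the error of the
estimate in a direction x is a weighted sum of independent centred noises, sub-Gaussian with proxy
at most 2d / `budget`. The number of arms is unbounded, so no union bound over arms is possible.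
Instead the error is controlled at the 2d points of `exists_tuple` to precision 2^(-l) / √(2d),
which by Cauchy–Schwarz yields 2^(-l) on all of A (`exists_norming`). This is what the second factor
d in the number of pulls pays for. The start state depends on earlier noise only, so conditioning on
it is a product of probabilities, and a completed phase is inaccurate with total probability at most
4/(MT) (`measure_failure_le`).

Regret. Without a failure the best arm survives and active arms in phase l have gap at most 8 ·
2^(-l) (`gap_le_of_not_failure`). Phase l then costs a multiple of 2^l d² log(MT) for the assigned
pulls and of M² for the idle slots around them. Phases with 2^l above a threshold B are charged 8/B
per pull instead; B = √(MT) / (d √log(MT)) balances the two and gives d √(MT log T). There are O(log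
T) phases, whence the term M² log T and the communication bound: in a phase the blocks of the agents
overlap in few arms, so the assignments and reports have length of order d log log d + M, and the
estimates cost Md. -/

namespace DELB

/-! ### Exact D-optimal designs -/

section DOptimal

open Matrix

/-- The determinant of a matrix after adding `x xᵀ` and removing `v vᵀ`. -/
lemma det_exchange {r : ℕ} (G : Matrix (Fin r) (Fin r) ℝ) (hG : IsUnit G.det)
    (hs : G.IsSymm) (x v : Fin r → ℝ) :
    (G + (vecMulVec x x - vecMulVec v v)).det =
      G.det * ((1 + x ⬝ᵥ G⁻¹ *ᵥ x) * (1 - v ⬝ᵥ G⁻¹ *ᵥ v) + (v ⬝ᵥ G⁻¹ *ᵥ x) ^ 2) := by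
  -- Factor the perturbation through ℝ² so that the matrix determinant lemma reduces the claim to a
  -- 2 × 2 determinant.
  have hUV : vecMulVec x x - vecMulVec v v
      = (Matrix.of fun k (e : Fin 2) => if e = 0 then x k else -v k) *
        (Matrix.of fun (e : Fin 2) k => if e = 0 then x k else v k) := by
    ext k k'
    simp [Matrix.mul_apply, Fin.sum_univ_two, vecMulVec_apply]
    ring
  have hent : ∀ e e' : Fin 2,
      ((Matrix.of fun (e : Fin 2) k => if e = 0 then x k else v k) * G⁻¹ *
        (Matrix.of fun k (e : Fin 2) => if e = 0 then x k else -v k)) e e' =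
      (if e = 0 then x else v) ⬝ᵥ G⁻¹ *ᵥ (if e' = 0 then x else -v) := by
    intro e e'
    rw [Matrix.mul_assoc, Matrix.mul_apply]
    simp only [dotProduct, Matrix.mul_apply, mulVec, Matrix.of_apply]
    fin_cases e <;> fin_cases e' <;> simp
  have hsym : x ⬝ᵥ G⁻¹ *ᵥ v = v ⬝ᵥ G⁻¹ *ᵥ x := by
    rw [dotProduct_mulVec, dotProduct_comm, ← mulVec_transpose, transpose_nonsing_inv, hs.eq]
  rw [hUV, det_add_mul _ _ hG, det_fin_two]
  simp only [Matrix.add_apply, hent]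
  simp only [mulVec_neg, dotProduct_neg, hsym, Matrix.one_apply, Fin.isValue, if_true, one_ne_zero,
    zero_ne_one, if_false]
  ring

/-- A basis extracted from the family fills the first r places and an arbitrary member the rest. It
guarantees that the maximal determinant is positive. -/
lemma exists_spanning_tuple {r n : ℕ} {ι : Type*} [Nonempty ι] (a : ι → Fin r → ℝ)
    (ha : Submodule.span ℝ (Set.range a) = ⊤) (hn : r ≤ n) :
    ∃ f : Fin n → ι, Submodule.span ℝ (Set.range (a ∘ f)) = ⊤ := by
  obtain ⟨κ, k, -, hspan, hli⟩ := exists_linearIndependent' ℝ a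
  have : Finite κ := hli.finite
  have := Fintype.ofFinite κ
  rw [ha] at hspan
  have hcard : Fintype.card κ = r := by
    have := finrank_span_eq_card hli
    rw [hspan, finrank_top] at this
    simpa using this.symm
  let e : κ ≃ Fin r := Fintype.equivFinOfCardEq hcard
  refine ⟨fun j => if h : (j : ℕ) < r then k (e.symm ⟨j, h⟩) else Classical.arbitrary ι, ?_⟩
  rw [eq_top_iff, ← hspan]
  apply Submodule.span_mono
  rintro _ ⟨c, rfl⟩
  refine ⟨⟨e c, (e c).2.trans_le hn⟩, ?_⟩
  simp

/-- A tuple of `n ≥ 2 r` vectors of a spanning family of `ℝ^r` which maximizes the determinant of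
the moment matrix `G` satisfies `xᵀ G⁻¹ x ≤ 1` for all `x` in the family. -/
lemma exists_tuple_of_span_eq_top {r n : ℕ} {ι : Type*} [Finite ι] [Nonempty ι]
    (a : ι → Fin r → ℝ) (ha : Submodule.span ℝ (Set.range a) = ⊤) (hn0 : 0 < n)
    (hn : 2 * r ≤ n) :
    ∃ f : Fin n → ι, ∀ i, ∃ u : Fin r → ℝ,
      ∑ j, (a (f j) ⬝ᵥ u) • a (f j) = a i ∧ a i ⬝ᵥ u ≤ 1 := by
  let X : (Fin n → ι) → Matrix (Fin n) (Fin r) ℝ := fun f => Matrix.of fun j => a (f j)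
  let G : (Fin n → ι) → Matrix (Fin r) (Fin r) ℝ := fun f => (X f)ᵀ * X f
  have hGsum : ∀ f, G f = ∑ j, vecMulVec (a (f j)) (a (f j)) := by
    intro f
    ext k k'
    simp [G, X, Matrix.mul_apply, Matrix.sum_apply, vecMulVec_apply]
  obtain ⟨f₁, hf₁⟩ := exists_spanning_tuple a ha (by lia : r ≤ n)
  obtain ⟨f, hf⟩ := Finite.exists_max fun f => (G f).det
  have hpos : 0 < (G f).det := by
    refine lt_of_lt_of_le ?_ (hf f₁)
    refine Matrix.PosDef.det_pos ?_
    have := Matrix.PosDef.conjTranspose_mul_self (X f₁) ?_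
    · simpa [G, conjTranspose_eq_transpose_of_trivial] using this
    · rw [← Matrix.coe_mulVecLin, ← LinearMap.ker_eq_bot, LinearMap.ker_eq_bot']
      intro v hv
      have hv' : ∀ j, a (f₁ j) ⬝ᵥ v = 0 := fun j => congrFun hv j
      have hall : ∀ w ∈ Submodule.span ℝ (Set.range (a ∘ f₁)), w ⬝ᵥ v = 0 := by
        intro w hw
        induction hw using Submodule.span_induction with
        | mem w hw => obtain ⟨j, rfl⟩ := hw; exact hv' j
        | zero => simp
        | add w w' _ _ h h' => rw [add_dotProduct, h, h', add_zero]
        | smul c w _ h => rw [smul_dotProduct, h, smul_zero]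
      exact dotProduct_self_eq_zero.1 (hall v (hf₁ ▸ Submodule.mem_top))
  have hunit : IsUnit (G f).det := hpos.ne'.isUnit
  have hsymm : (G f).IsSymm := by simp [G, Matrix.IsSymm]
  refine ⟨f, fun i => ⟨(G f)⁻¹ *ᵥ a i, ?_, ?_⟩⟩
  · have h : G f *ᵥ ((G f)⁻¹ *ᵥ a i) = a i := by
      rw [mulVec_mulVec, Matrix.mul_nonsing_inv _ hunit, one_mulVec]
    conv_rhs => rw [← h]
    rw [hGsum f, sum_mulVec]
    refine Finset.sum_congr rfl fun j _ => ?_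
    rw [vecMulVec_mulVec]
    simp
  · set q := a i ⬝ᵥ (G f)⁻¹ *ᵥ a i with hq
    -- Maximality under the exchange of the j-th point for `a i`; the square in `det_exchange` is
    -- dropped.
    have hex : ∀ j, (1 + q) * (1 - a (f j) ⬝ᵥ (G f)⁻¹ *ᵥ a (f j)) ≤ 1 := by
      intro j
      have hupd : G (Function.update f j i) =
          G f + (vecMulVec (a i) (a i) - vecMulVec (a (f j)) (a (f j))) := by
        rw [hGsum, hGsum, ← Finset.add_sum_erase _ _ (Finset.mem_univ j),
          ← Finset.add_sum_erase _ (fun j => vecMulVec (a (f j)) (a (f j))) (Finset.mem_univ j)]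
        rw [Finset.sum_congr rfl (g := fun j => vecMulVec (a (f j)) (a (f j)))]
        · simp; abel
        · intro j' hj'
          rw [Function.update_of_ne (Finset.ne_of_mem_erase hj')]
      have h1 := hf (Function.update f j i)
      simp only [hupd] at h1
      rw [det_exchange _ hunit hsymm, mul_le_iff_le_one_right hpos] at h1
      nlinarith [sq_nonneg (a (f j) ⬝ᵥ (G f)⁻¹ *ᵥ a i)]
    -- The leverages of the chosen points sum to the trace of the identity.
    have htr : ∑ j, a (f j) ⬝ᵥ (G f)⁻¹ *ᵥ a (f j) = r := by
      have h1 : ∑ j, a (f j) ⬝ᵥ (G f)⁻¹ *ᵥ a (f j) = (X f * (G f)⁻¹ * (X f)ᵀ).trace := by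
        refine Finset.sum_congr rfl fun j _ => ?_
        rw [Matrix.mul_assoc, Matrix.diag_apply, Matrix.mul_apply]
        simp only [dotProduct, mulVec, Matrix.mul_apply, X, Matrix.of_apply, transpose_apply]
      rw [h1, Matrix.mul_assoc, Matrix.trace_mul_comm, Matrix.mul_assoc]
      change ((G f)⁻¹ * G f).trace = r
      rw [Matrix.nonsing_inv_mul _ hunit]
      simp
    -- The sum reads (1 + q)(n - r) ≤ n, and n - r ≥ n/2 > 0 forces q ≤ 1.
    have hsum := Finset.sum_le_sum fun j (_ : j ∈ Finset.univ) => hex j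
    rw [← Finset.mul_sum, Finset.sum_sub_distrib, htr] at hsum
    simp only [Finset.sum_const, Finset.card_univ, Fintype.card_fin, nsmul_eq_mul, mul_one] at hsum
    have hn' : (2 : ℝ) * r ≤ n := by exact_mod_cast hn
    have hn0' : (0 : ℝ) < n := by exact_mod_cast hn0
    by_contra! hlt
    nlinarith

end DOptimal

/-- Every finite nonempty set `A` in `ℝ^d` contains `2 d` points (with repetition) through which all
points of `A` can be expressed with coefficients of square sum at most `1`. -/
lemma exists_tuple {d : ℕ} (hd : 0 < d) (A : Finset (Vec d)) (hA : A.Nonempty) :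
    ∃ f : Fin (2 * d) → Vec d, (∀ j, f j ∈ A) ∧
      ∀ x ∈ A, ∃ u ∈ Submodule.span ℝ (A : Set (Vec d)),
        ∑ j, inner ℝ (f j) u • f j = x ∧ inner ℝ x u ≤ 1 := by
  set E := Submodule.span ℝ (A : Set (Vec d)) with hE
  set r := Module.finrank ℝ E with hr
  let b := stdOrthonormalBasis ℝ E
  have hAE : ∀ x : A, (x : Vec d) ∈ E := fun x => Submodule.subset_span x.2
  let lift : A → E := fun x => ⟨x, hAE x⟩
  -- Orthonormal coordinates of the span turn inner products into dot products and make the family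
  -- spanning; its dimension r is at most d, so 2d points are enough.
  let L : E ≃ₗ[ℝ] (Fin r → ℝ) :=
    b.repr.toLinearEquiv.trans (WithLp.linearEquiv 2 ℝ (Fin r → ℝ))
  have hL : ∀ v w : E, L v ⬝ᵥ L w = inner ℝ (v : Vec d) (w : Vec d) := by
    intro v w
    rw [← Submodule.coe_inner, ← b.repr.inner_map_map v w]
    simp only [PiLp.inner_apply, RCLike.inner_apply, conj_trivial, dotProduct]
    exact Finset.sum_congr rfl fun _ _ => mul_comm _ _
  have hspan : Submodule.span ℝ (Set.range fun x : A => L (lift x)) = ⊤ := by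
    have h1 : Submodule.span ℝ (Set.range lift) = ⊤ := by
      have : Set.range lift = (Subtype.val ⁻¹' (A : Set (Vec d)) : Set E) := by
        ext y
        constructor
        · rintro ⟨x, rfl⟩; exact x.2
        · intro hy; exact ⟨⟨y, hy⟩, rfl⟩
      rw [this]
      exact Submodule.span_span_coe_preimage
    have h2 : (Set.range fun x : A => L (lift x)) = L '' Set.range lift := by
      rw [← Set.range_comp]; rfl
    rw [h2]
    have h3 := Submodule.map_span (L : E →ₗ[ℝ] (Fin r → ℝ)) (Set.range lift)
    rw [h1, Submodule.map_top, LinearEquiv.range] at h3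
    exact h3.symm
  have : Nonempty A := hA.to_subtype
  have hrd : r ≤ d := by simpa using Submodule.finrank_le E
  obtain ⟨f, hf⟩ := exists_tuple_of_span_eq_top (n := 2 * d) _ hspan (by lia) (by lia)
  refine ⟨fun j => f j, fun j => (f j).2, fun x hx => ?_⟩
  obtain ⟨u, hu, hle⟩ := hf ⟨x, hx⟩
  obtain ⟨v, rfl⟩ := L.surjective u
  refine ⟨v, v.2, ?_, ?_⟩
  · have h : L (∑ j, inner ℝ (f j : Vec d) (v : Vec d) • lift (f j)) = L (lift ⟨x, hx⟩) := by
      rw [← hu, map_sum]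
      refine Finset.sum_congr rfl fun j _ => ?_
      rw [map_smul, hL]
    have h' := congrArg Subtype.val (L.injective h)
    simpa [lift] using h'
  · rw [hL] at hle
    exact hle

/-- A norming set of at most `2 d` points. -/
lemma exists_norming {d : ℕ} (hd : 0 < d) (A : Finset (Vec d)) (hA : A.Nonempty) :
    ∃ f : Fin (2 * d) → Vec d, (∀ j, f j ∈ A) ∧
      ∀ (e : Vec d) (ε : ℝ), 0 ≤ ε → (∀ j, |inner ℝ e (f j)| ≤ ε / √(2 * d)) →
        ∀ x ∈ A, |inner ℝ e x| ≤ ε := by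
  obtain ⟨f, hfA, hf⟩ := exists_tuple hd A hA
  refine ⟨f, hfA, fun e ε hε he x hx => ?_⟩
  obtain ⟨u, -, hux, hle⟩ := hf x hx
  have hd' : (0 : ℝ) < 2 * d := by positivity
  have h1 : inner ℝ e x = ∑ j, inner ℝ (f j) u * inner ℝ e (f j) := by
    conv_lhs => rw [← hux]
    rw [inner_sum]
    exact Finset.sum_congr rfl fun j _ => inner_smul_right _ _ _
  have h2 : ∑ j, inner ℝ (f j) u ^ 2 ≤ 1 := by
    refine le_trans (le_of_eq ?_) hle
    conv_rhs => rw [← hux]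
    rw [sum_inner]
    refine Finset.sum_congr rfl fun j _ => ?_
    rw [real_inner_smul_left, sq]
  have h3 : ∑ j, inner ℝ e (f j) ^ 2 ≤ ε ^ 2 := by
    calc ∑ j, inner ℝ e (f j) ^ 2 ≤ ∑ _j : Fin (2 * d), ε ^ 2 / (2 * d) := by
          refine Finset.sum_le_sum fun j _ => ?_
          have := pow_le_pow_left₀ (abs_nonneg _) (he j) 2
          rwa [sq_abs, div_pow, Real.sq_sqrt hd'.le] at this
      _ = ε ^ 2 := by simp; field_simp
  apply abs_le_of_sq_le_sq _ hε
  rw [h1]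
  calc (∑ j, inner ℝ (f j) u * inner ℝ e (f j)) ^ 2
      ≤ (∑ j, inner ℝ (f j) u ^ 2) * ∑ j, inner ℝ e (f j) ^ 2 :=
        Finset.sum_mul_sq_le_sq_mul_sq _ _ _
    _ ≤ 1 * ε ^ 2 := by gcongr
    _ = ε ^ 2 := one_mul _

/-! ### Existence of a rule for choosing designs -/

/-- This makes 2d ≤ 48 d log log d, so that a support of 2d points is admissible already for d = 3.
Both logarithms are bounded by log x ≥ 1 - 1/x, the inner one after splitting off log e. -/
lemma one_div_le_log_log {d : ℕ} (hd : 3 ≤ d) : 1 / 24 ≤ Real.log (Real.log d) := by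
  have h3 : (3 : ℝ) ≤ d := by exact_mod_cast hd
  have hl : 24 / 23 ≤ Real.log d := by
    have h1 : Real.log 3 ≤ Real.log d := Real.log_le_log (by norm_num) h3
    have h2 : 1 - (3 / Real.exp 1)⁻¹ ≤ Real.log (3 / Real.exp 1) :=
      Real.one_sub_inv_le_log_of_pos (by positivity)
    rw [Real.log_div (by norm_num) (Real.exp_ne_zero _), Real.log_exp, inv_div] at h2
    have h4 := Real.exp_one_lt_d9
    linarith
  have h5 : 1 - (Real.log d)⁻¹ ≤ Real.log (Real.log d) :=
    Real.one_sub_inv_le_log_of_pos (by linarith)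
  have h6 : (Real.log d)⁻¹ ≤ (24 / 23)⁻¹ := inv_anti₀ (by norm_num) hl
  norm_num at h6 ⊢
  linarith

lemma pulls_mono {d M T l : ℕ} (hMT : 1 ≤ M * T) {δ : Design d} {c c' : ℕ}
    (h : δ.weight c' ≤ δ.weight c) : pulls M T l δ c' ≤ pulls M T l δ c := by
  unfold pulls
  have : 0 ≤ Real.log (M * T) := Real.log_nonneg (by exact_mod_cast hMT)
  gcongr

/-- A weight on a finite set can be listed as a design, by decreasing weight. -/
lemma exists_design_of_weight {d : ℕ} (S : Finset (Vec d)) (w : Vec d → ℝ) :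
    ∃ δ : Design d, δ.size = S.card ∧ (∀ c < δ.size, δ.arm c ∈ S) ∧
      (∀ c < δ.size, ∀ c' < δ.size, δ.arm c = δ.arm c' → c = c') ∧
      (∀ c < δ.size, δ.weight c = w (δ.arm c)) ∧
      (∀ c c', c ≤ c' → c' < δ.size → δ.weight c' ≤ δ.weight c) ∧
      ∀ {V : Type} [AddCommMonoid V] (g : Vec d → V),
        ∑ c ∈ Finset.range δ.size, g (δ.arm c) = ∑ x ∈ S, g x := by
  let e : Fin S.card ≃ S := S.equivFin.symm
  -- Sorting the negated weights in increasing order lists the weights in decreasing order.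
  let σ := Tuple.sort fun j => -w (e j)
  have hσ := Tuple.monotone_sort fun j => -w (e j)
  let arm : ℕ → Vec d := fun c => if h : c < S.card then e (σ ⟨c, h⟩) else 0
  have harm : ∀ c (h : c < S.card), arm c = e (σ ⟨c, h⟩) := fun c h => dif_pos h
  refine ⟨⟨S.card, arm, fun c => w (arm c)⟩, rfl, ?_, ?_, fun _ _ => rfl, ?_, ?_⟩
  · intro c hc
    simp only at hc ⊢
    rw [harm c hc]
    exact (e _).2
  · intro c hc c' hc' h
    simp only at hc hc' h
    rw [harm c hc, harm c' hc'] at h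
    have := σ.injective (e.injective (Subtype.ext h))
    simpa using this
  · intro c c' hcc hc'
    simp only at hc' ⊢
    rw [harm c' hc', harm c (hcc.trans_lt hc')]
    have := @hσ ⟨c, hcc.trans_lt hc'⟩ ⟨c', hc'⟩ hcc
    simpa using this
  · intro V _ g
    simp only
    rw [Finset.sum_range, ← Finset.sum_coe_sort S, ← (σ.trans e).sum_comp]
    exact Finset.sum_congr rfl fun j _ => by rw [harm j j.2]; rfl

/-- Uniform weight on the 2d points of `exists_tuple`, where a point that occurs k times gets weight
k / (2d). -/
lemma exists_isDesign {d : ℕ} (hd : 3 ≤ d) {M T : ℕ} (hMT : 1 ≤ M * T) (l : ℕ)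
    (A : Finset (Vec d)) (hA : A.Nonempty) : ∃ δ : Design d, IsDesign M T l A δ := by
  classical
  obtain ⟨f, hfA, hf⟩ := exists_tuple (by lia : 0 < d) A hA
  let S := Finset.univ.image f
  let k : Vec d → ℕ := fun x => (Finset.univ.filter fun j => f j = x).card
  have hd0 : (0 : ℝ) < 2 * d := by
    have : (0 : ℝ) < d := by exact_mod_cast (by lia : 0 < d)
    linarith
  obtain ⟨δ, hsize, hmem, hinj, hw, hmono, hsum⟩ :=
    exists_design_of_weight S fun x => (k x : ℝ) / (2 * d)
  have hfib : ∀ {V : Type} [AddCommMonoid V] (g : Vec d → V),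
      ∑ j, g (f j) = ∑ x ∈ S, k x • g x := by
    intro V _ g
    rw [← Finset.sum_fiberwise_of_maps_to (s := Finset.univ) (t := S) (g := f)
      fun j _ => Finset.mem_image_of_mem f (Finset.mem_univ j)]
    refine Finset.sum_congr rfl fun x _ => ?_
    rw [Finset.sum_congr rfl (g := fun _ => g x), Finset.sum_const]
    intro j hj
    rw [(Finset.mem_filter.1 hj).2]
  refine ⟨δ, ?_, hinj, ?_, ?_, ?_, ?_, ?_⟩
  · intro c hc
    obtain ⟨j, -, hj⟩ := Finset.mem_image.1 (hmem c hc)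
    exact hj ▸ hfA j
  · intro c hc
    rw [hw c hc]
    obtain ⟨j, -, hj⟩ := Finset.mem_image.1 (hmem c hc)
    have : 0 < k (δ.arm c) := Finset.card_pos.2 ⟨j, by simp [hj]⟩
    positivity
  · rw [Finset.sum_congr rfl fun c hc => hw c (Finset.mem_range.1 hc),
      hsum (fun x => (k x : ℝ) / (2 * d))]
    have h := hfib (V := ℝ) fun _ => 1 / (2 * d)
    simp only [nsmul_eq_mul, mul_one_div] at h
    rw [← h]
    simp
    field_simp
  · have h1 : δ.size ≤ 2 * d := by
      rw [hsize]
      exact Finset.card_image_le.trans (by simp)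
    have h2 : (δ.size : ℝ) ≤ 2 * d := by exact_mod_cast h1
    nlinarith [one_div_le_log_log hd]
  · intro x hx
    obtain ⟨u, hu, hux, hle⟩ := hf x hx
    -- Normalizing the weights divides the moment operator by 2d, so the preimage and the leverage
    -- bound 1 are multiplied by 2d.
    refine ⟨(2 * (d : ℝ)) • u, Submodule.smul_mem _ _ hu, ?_, ?_⟩
    · unfold Design.moment
      rw [Finset.sum_congr rfl fun c hc => by rw [hw c (Finset.mem_range.1 hc)],
        hsum (fun y => ((k y : ℝ) / (2 * d) * inner ℝ y ((2 * (d : ℝ)) • u)) • y), ← hux,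
        hfib fun y => inner ℝ y u • y]
      refine Finset.sum_congr rfl fun y _ => ?_
      rw [← Nat.cast_smul_eq_nsmul ℝ, smul_smul, real_inner_smul_right]
      congr 1
      field_simp
    · rw [real_inner_smul_right]
      nlinarith
  · intro c c' hcc hc'
    exact pulls_mono hMT (hmono c c' hcc hc')

lemma exists_valid_rule {d : ℕ} (hd : 3 ≤ d) {M T : ℕ} (hMT : 1 ≤ M * T) :
    ∃ R : DesignRule d, R.Valid M T := by
  classical
  refine ⟨fun l A => if h : A.Nonempty then (exists_isDesign hd hMT l A h).choose
    else ⟨0, fun _ => 0, fun _ => 0⟩, fun l A hA => ?_⟩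
  simp only [dif_pos hA]
  exact (exists_isDesign hd hMT l A hA).choose_spec

section

/-! ### Combinatorics of the assignment -/

lemma sum_range_getElem?_elim {V : Type*} [AddCommMonoid V] (g : ℕ → V) (L : List ℕ) {p : ℕ}
    (h : L.length ≤ p) :
    ∑ k ∈ Finset.range p, (L[k]?).elim 0 g = (L.map g).sum := by
  induction L generalizing p with
  | nil => simp
  | cons c L ih =>
    obtain ⟨p, rfl⟩ : ∃ p', p = p' + 1 := ⟨p - 1, by simp at h; lia⟩
    rw [Finset.sum_range_succ']
    simp only [List.getElem?_cons_succ, List.getElem?_cons_zero, Option.elim_some, List.map_cons,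
      List.sum_cons]
    rw [ih (by simpa using h), add_comm]

lemma count_expand (w : List (ℕ × ℕ)) (c : ℕ) :
    (expand w).count c = (w.map fun q => if q.1 = c then q.2 else 0).sum := by
  induction w with
  | nil => simp [expand]
  | cons q w ih =>
    have h : expand (q :: w) = List.replicate q.2 q.1 ++ expand w := rfl
    rw [h, List.count_append, ih, List.count_replicate]
    simp

lemma mem_expand {w : List (ℕ × ℕ)} {c : ℕ} : c ∈ expand w ↔ ∃ k, (c, k) ∈ w ∧ 0 < k := by
  simp only [expand, List.mem_flatMap, List.mem_replicate]
  constructor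
  · rintro ⟨q, hq, h0, rfl⟩
    exact ⟨q.2, hq, Nat.pos_of_ne_zero h0⟩
  · rintro ⟨k, hk, h0⟩
    exact ⟨_, hk, h0.ne', rfl⟩

/-- All pulls of a phase, arm by arm. -/
def schedule (n : ℕ) (m : ℕ → ℕ) : List ℕ := expand ((List.range n).map fun c => (c, m c))

lemma schedule_succ (n : ℕ) (m : ℕ → ℕ) :
    schedule (n + 1) m = schedule n m ++ List.replicate (m n) n := by
  simp [schedule, expand, List.range_succ, List.flatMap_append]

lemma length_schedule (n : ℕ) (m : ℕ → ℕ) :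
    (schedule n m).length = ∑ c ∈ Finset.range n, m c := by
  induction n with
  | zero => simp [schedule, expand]
  | succ n ih => rw [schedule_succ, List.length_append, ih, Finset.sum_range_succ]; simp

lemma lt_of_mem_schedule {n : ℕ} {m : ℕ → ℕ} {c : ℕ} (h : c ∈ schedule n m) : c < n := by
  obtain ⟨k, hk, -⟩ := mem_expand.1 h
  simp only [List.mem_map, List.mem_range, Prod.mk.injEq] at hk
  obtain ⟨c', hc', rfl, -⟩ := hk
  exact hc'

lemma count_schedule (n : ℕ) (m : ℕ → ℕ) (c : ℕ) :
    (schedule n m).count c = if c < n then m c else 0 := by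
  induction n with
  | zero => simp [schedule, expand]
  | succ n ih =>
    rw [schedule_succ, List.count_append, ih, List.count_replicate]
    rcases lt_trichotomy c n with h | rfl | h
    · simp [h, h.ne', Nat.lt_succ_of_lt h]
    · simp
    · simp [h.ne, not_lt.2 h.le, not_lt.2 (Nat.succ_le_of_lt h)]

lemma pairwise_schedule (n : ℕ) (m : ℕ → ℕ) : (schedule n m).Pairwise (· ≤ ·) := by
  induction n with
  | zero => simp [schedule, expand]
  | succ n ih =>
    rw [schedule_succ, List.pairwise_append]
    refine ⟨ih, List.pairwise_replicate.2 (Or.inr le_rfl), fun c hc c' hc' => ?_⟩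
    rw [List.eq_of_mem_replicate hc']
    exact (lt_of_mem_schedule hc).le

variable {M n : ℕ} {m : ℕ → ℕ}

lemma block_eq (M n : ℕ) (m : ℕ → ℕ) (j : ℕ) :
    block M n m j = ((schedule n m).drop (j * perAgent M n m)).take (perAgent M n m) := rfl

lemma lt_of_mem_block {j c : ℕ} (h : c ∈ block M n m j) : c < n :=
  lt_of_mem_schedule (List.mem_of_mem_drop (List.mem_of_mem_take h))

lemma length_block_le (j : ℕ) : (block M n m j).length ≤ perAgent M n m := by
  rw [block_eq]; exact List.length_take_le _ _

lemma sum_le_mul_perAgent (hM : 1 ≤ M) (n : ℕ) (m : ℕ → ℕ) :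
    ∑ c ∈ Finset.range n, m c ≤ M * perAgent M n m := by
  have := le_smul_ceilDiv (α := ℕ) (b := ∑ c ∈ Finset.range n, m c) (show 0 < M by lia)
  simpa [perAgent] using this

lemma mul_perAgent_lt (hM : 1 ≤ M) (n : ℕ) (m : ℕ → ℕ) :
    M * perAgent M n m < ∑ c ∈ Finset.range n, m c + M := by
  rw [perAgent, Nat.ceilDiv_eq_add_pred_div]
  have := Nat.mul_div_le (∑ c ∈ Finset.range n, m c + M - 1) M
  lia

/-- Consecutive blocks concatenate to a prefix of the schedule. With k = M the prefix is the whole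
schedule, because of the rounding up in `perAgent`. -/
lemma sum_count_block (c k : ℕ) :
    ∑ j ∈ Finset.range k, (block M n m j).count c =
      ((schedule n m).take (k * perAgent M n m)).count c := by
  induction k with
  | zero => simp
  | succ k ih =>
    rw [Finset.sum_range_succ, ih, Nat.succ_mul, List.take_add, List.count_append, block_eq]

lemma sum_count_block_eq (hM : 1 ≤ M) {c : ℕ} (hc : c < n) :
    ∑ j ∈ Finset.range M, (block M n m j).count c = m c := by
  rw [sum_count_block, List.take_of_length_le, count_schedule, if_pos hc]
  rw [length_schedule]
  exact sum_le_mul_perAgent hM n m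

lemma count_expand_assignment (j c : ℕ) :
    (expand (assignment M n m j)).count c = (block M n m j).count c := by
  rw [count_expand, assignment, List.map_map]
  set S := (List.range n).filter fun c => decide (0 < (block M n m j).count c)
  have hS : S.Nodup := List.nodup_range.filter _
  have h1 : (List.map ((fun q : ℕ × ℕ => if q.1 = c then q.2 else 0) ∘
      fun c => (c, (block M n m j).count c)) S).sum =
      ∑ c' ∈ S.toFinset, if c' = c then (block M n m j).count c' else 0 := by
    rw [List.sum_toFinset _ hS]
    rfl
  rw [h1, Finset.sum_ite_eq']
  split_ifs with h
  · rfl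
  · by_contra hne
    apply h
    rw [List.mem_toFinset, List.mem_filter]
    have hpos : 0 < (block M n m j).count c := Nat.pos_of_ne_zero fun h0 => hne h0.symm
    exact ⟨List.mem_range.2 (lt_of_mem_block (List.count_pos_iff.1 hpos)), by simpa using hpos⟩

/-- Only multiplicities enter the sums of rewards, so agreement up to order is all that is needed of
the encoding as pairs. -/
lemma perm_expand_assignment (j : ℕ) :
    (expand (assignment M n m j)).Perm (block M n m j) :=
  List.perm_iff_count.2 fun c => count_expand_assignment j c

lemma length_expand_assignment_le (j : ℕ) :
    (expand (assignment M n m j)).length ≤ perAgent M n m := by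
  rw [(perm_expand_assignment j).length_eq]; exact length_block_le j

lemma lt_of_mem_expand_assignment {j c : ℕ} (h : c ∈ expand (assignment M n m j)) : c < n :=
  lt_of_mem_block ((perm_expand_assignment j).mem_iff.1 h)

/-- Summation over all assigned pulls of a phase. -/
lemma sum_assigned {V : Type*} [AddCommMonoid V] (hM : 1 ≤ M) (g : ℕ → V) :
    ∑ j ∈ Finset.range M, ∑ k ∈ Finset.range (perAgent M n m),
      ((expand (assignment M n m j))[k]?).elim 0 g = ∑ c ∈ Finset.range n, m c • g c := by
  have h1 : ∀ j, ∑ k ∈ Finset.range (perAgent M n m),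
      ((expand (assignment M n m j))[k]?).elim 0 g =
      ∑ c ∈ Finset.range n, (block M n m j).count c • g c := by
    intro j
    rw [sum_range_getElem?_elim g _ (length_expand_assignment_le j)]
    rw [((perm_expand_assignment j).map g).sum_eq, ← Multiset.sum_coe, ← Multiset.map_coe,
      Finset.sum_multiset_map_count]
    refine Finset.sum_subset_zero_on_sdiff ?_ ?_ ?_
    · intro c hc
      simp only [Multiset.mem_toFinset, Multiset.mem_coe] at hc
      exact Finset.mem_range.2 (lt_of_mem_block hc)
    · intro c hc
      simp only [Finset.mem_sdiff, Multiset.mem_toFinset, Multiset.mem_coe] at hc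
      rw [List.count_eq_zero_of_not_mem hc.2, zero_smul]
    · intro c _
      simp
  simp only [h1]
  rw [Finset.sum_comm]
  refine Finset.sum_congr rfl fun c hc => ?_
  rw [← Finset.sum_smul, sum_count_block_eq hM (Finset.mem_range.1 hc)]

/-- The schedule is sorted by arm and the block of j lies entirely before that of j'. -/
lemma le_of_mem_block {j j' c c' : ℕ} (hj : j < j') (hc : c ∈ block M n m j)
    (hc' : c' ∈ block M n m j') : c ≤ c' := by
  set p := perAgent M n m with hp
  have h1 : c ∈ (schedule n m).take (j' * p) := by
    have : block M n m j = (((schedule n m).take ((j + 1) * p)).drop (j * p)) := by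
      rw [block_eq, List.drop_take, ← hp]
      congr 1
      rw [Nat.succ_mul, Nat.add_sub_cancel_left]
    rw [this] at hc
    exact List.take_subset_take_left _ (Nat.mul_le_mul_right p hj) (List.mem_of_mem_drop hc)
  have h2 : c' ∈ (schedule n m).drop (j' * p) := List.mem_of_mem_take hc'
  have h3 := pairwise_schedule n m
  rw [← List.take_append_drop (j' * p) (schedule n m), List.pairwise_append] at h3
  exact h3.2.2 c h1 c' h2

/-- Since the blocks are consecutive, few arms are assigned to more than one agent. -/
lemma sum_length_assignment_le (M n : ℕ) (m : ℕ → ℕ) :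
    ∑ j ∈ Finset.range M, (assignment M n m j).length ≤ n + M := by
  have h1 : ∀ j, (assignment M n m j).length =
      ((Finset.range n).filter fun c => c ∈ block M n m j).card := by
    intro j
    rw [assignment, List.length_map, ← List.toFinset_card_of_nodup (List.nodup_range.filter _)]
    congr 1
    ext c
    simp [List.count_pos_iff]
  simp only [h1]
  rw [← Finset.card_sigma]
  -- The map (j, c) ↦ j + c is injective on pairs with c assigned to j: a larger j never comes with
  -- a smaller c, so the sum strictly increases with j.
  have h2 := Finset.card_le_card_of_injOn (t := Finset.range (n + M))
    (s := (Finset.range M).sigma fun j => (Finset.range n).filter fun c => c ∈ block M n m j)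
    (fun x => x.1 + x.2) ?_ ?_
  · simpa using h2
  · rintro ⟨j, c⟩ h
    simp only [Finset.coe_sigma, Set.mem_sigma_iff, Finset.mem_coe, Finset.mem_range,
      Finset.mem_filter] at h ⊢
    lia
  · rintro ⟨j, c⟩ h ⟨j', c'⟩ h' heq
    simp only [Finset.coe_sigma, Set.mem_sigma_iff, Finset.mem_coe, Finset.mem_range,
      Finset.mem_filter] at h h' heq
    rcases lt_trichotomy j j' with hlt | rfl | hlt
    · have := le_of_mem_block hlt h.2.2 h'.2.2; lia
    · have : c = c' := by lia
      subst this; rfl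
    · have := le_of_mem_block hlt h'.2.2 h.2.2; lia

/-- The averages reported for the assigned arms allow to recover the sums. -/
lemma sum_report (j : ℕ) (S : ℕ → ℝ) {c : ℕ} (hS : c ∉ expand (assignment M n m j) → S c = 0) :
    (((assignment M n m j).zip ((assignment M n m j).map fun q => S q.1 / q.2)).map
      fun q => if q.1.1 = c then (q.1.2 : ℝ) * q.2 else 0).sum = S c := by
  have hzip : ∀ w : List (ℕ × ℕ), (w.zip (w.map fun q => S q.1 / q.2)).map
      (fun q => if q.1.1 = c then (q.1.2 : ℝ) * q.2 else 0) =
      w.map fun q => if q.1 = c then (q.2 : ℝ) * (S q.1 / q.2) else 0 := by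
    intro w
    induction w with
    | nil => rfl
    | cons q w ih => simp only [List.map_cons, List.zip_cons_cons, ih]
  rw [hzip, assignment, List.map_map]
  set L := (List.range n).filter fun c => decide (0 < (block M n m j).count c)
  have hL : L.Nodup := List.nodup_range.filter _
  have h1 : (List.map ((fun q : ℕ × ℕ => if q.1 = c then (q.2 : ℝ) * (S q.1 / q.2) else 0) ∘
      fun c => (c, (block M n m j).count c)) L).sum =
      ∑ c' ∈ L.toFinset, if c' = c then
        ((block M n m j).count c' : ℝ) * (S c' / (block M n m j).count c') else 0 := by
    rw [List.sum_toFinset _ hL]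
    rfl
  rw [h1, Finset.sum_ite_eq']
  have hmem : c ∈ L.toFinset ↔ c ∈ expand (assignment M n m j) := by
    rw [(perm_expand_assignment j).mem_iff, List.mem_toFinset, List.mem_filter]
    simp only [List.mem_range, decide_eq_true_eq, List.count_pos_iff]
    exact ⟨fun h => h.2, fun h => ⟨lt_of_mem_block h, h⟩⟩
  split_ifs with h
  -- Listed arms have a positive count, so multiplying by it undoes the division in the average.
  · have : 0 < (block M n m j).count c := by
      simpa using (List.mem_filter.1 (List.mem_toFinset.1 h)).2
    field_simp
  · rw [hS fun h' => h (hmem.2 h')]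

end

/-! ### The phases -/

/-- The common part of the local states: phase, step in the phase, and active set. -/
structure Cur {d : ℕ} (D : Finset (Vec d)) where
  phase : ℕ
  step : ℕ
  active : Finset (Vec d)
  sub : active ⊆ D
  ne : active.Nonempty

lemma eliminate_subset {d l : ℕ} {A : Finset (Vec d)} {v : Vec d} : eliminate l A v ⊆ A := by
  classical
  exact Finset.filter_subset _ _

lemma eliminate_nonempty {d l : ℕ} {A : Finset (Vec d)} {v : Vec d} (hA : A.Nonempty) :
    (eliminate l A v).Nonempty := by
  classical
  obtain ⟨x, hx, hmax⟩ := A.exists_max_image (fun x => inner ℝ v x) hA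
  refine ⟨x, Finset.mem_filter.2 ⟨hx, fun b hb => ?_⟩⟩
  rw [inner_sub_right]
  have := hmax b hb
  have : (0 : ℝ) ≤ 2 * (1 / 2) ^ l := by positivity
  linarith

/-! ### Local states as functions of the common state -/

namespace Cur

variable {d M : ℕ} (T : ℕ) (R : DesignRule d) {D : Finset (Vec d)} (q : Cur D)

/-- The design of the phase. -/
def design : Design d := R q.phase q.active

variable (M)

/-- Number of pulls of each arm. -/
noncomputable def num (c : ℕ) : ℕ := pulls M T q.phase (q.design R) c

/-- Length of the pulling stage. -/
noncomputable def pullLen : ℕ := perAgent M (q.design R).size (q.num M T R)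

/-- Assignment of agent number `j`. -/
noncomputable def work (j : ℕ) : List (ℕ × ℕ) :=
  assignment M (q.design R).size (q.num M T R) j

/-- The arm which agent `j` has to pull in the `k`-th step of the pulling stage. -/
noncomputable def pull (j k : ℕ) : Option ℕ := (expand (q.work M T R j))[k]?

/-- Length of the phase. -/
noncomputable def len : ℕ := 3 * (M - 1) + q.pullLen M T R

/-- The arm which agent `j` has to pull in the current step. -/
noncomputable def target (j : ℕ) : Option ℕ :=
  if M - 1 ≤ q.step ∧ q.step < (M - 1) + q.pullLen M T R then
    q.pull M T R j (q.step - (M - 1))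
  else none

variable {M}
variable (θ : Vec d) (N : ℕ → Fin M → Vec d → ℝ) (τ : ℕ)

/-- Sum of the rewards of the `c`-th arm in the first `K` pulls of agent `i`, in a phase which
starts at time `τ`. -/
noncomputable def localSum (i : Fin M) (K c : ℕ) : ℝ :=
  ∑ k ∈ Finset.range K, if q.pull M T R i k = some c then
    inner ℝ ((q.design R).arm c) θ + N (τ + (M - 1) + k) i ((q.design R).arm c) else 0

/-- Sum of all rewards of the `c`-th arm. -/
noncomputable def totalSum (c : ℕ) : ℝ :=
  ∑ i, q.localSum T R θ N τ i (q.pullLen M T R) c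

/-- The estimate at the end of the phase. -/
noncomputable def fit : Vec d :=
  estimate q.active (q.design R) (q.num M T R) (q.totalSum T R θ N τ)

/-- Sums known to agent `0` in step `s`. -/
noncomputable def serverSum (s c : ℕ) : ℝ :=
  ∑ i : Fin M, if (i : ℕ) = 0 then
      q.localSum T R θ N τ i (min (s - (M - 1)) (q.pullLen M T R)) c
    else if (M - 1) + q.pullLen M T R + i ≤ s then q.localSum T R θ N τ i (q.pullLen M T R) c
    else 0

/-- The state of agent `i` in step `s` of a phase which starts at time `τ`. -/
noncomputable def localState (s : ℕ) (i : Fin M) : LocalState d where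
  phase := q.phase
  step := s
  active := q.active
  -- The assignment of agent i ≥ 1 arrives in step i - 1, hence is visible from step i on; agent 0
  -- never stores its own.
  work := if (i : ℕ) = 0 then [] else if (i : ℕ) ≤ s then q.work M T R i else []
  sums := if (i : ℕ) = 0 then q.serverSum T R θ N τ s
    else q.localSum T R θ N τ i (min (s - (M - 1)) (q.pullLen M T R))
  est := if (i : ℕ) ≠ 0 ∧ 2 * (M - 1) + q.pullLen M T R + i ≤ s then q.fit T R θ N τ else 0

variable {T R θ N τ}

lemma localSum_eq_zero {i : Fin M} {K c : ℕ} (h : c ∉ expand (q.work M T R i)) :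
    q.localSum T R θ N τ i K c = 0 := by
  refine Finset.sum_eq_zero fun k _ => if_neg fun hk => h ?_
  exact List.mem_of_getElem? hk

lemma serverSum_eq_totalSum {s : ℕ} (hs : 2 * (M - 1) + q.pullLen M T R ≤ s) :
    q.serverSum T R θ N τ s = q.totalSum T R θ N τ := by
  funext c
  refine Finset.sum_congr rfl fun i _ => ?_
  have := i.2
  split_ifs with h1 h2
  · rw [min_eq_right (by lia)]
  · rfl
  · lia

/-- When pulling begins in step M - 1 ≥ i, agent i has already received its assignment. -/
lemma target_localState {i : Fin M} {s : ℕ} (hs : q.step = s) :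
    (q.localState T R θ N τ s i).target M T R i = q.target M T R i := by
  have := i.2
  unfold LocalState.target target
  change (if M - 1 ≤ s ∧ s < (M - 1) + q.pullLen M T R then _ else _) = _
  rw [hs]
  split_ifs with h
  · have : (q.localState T R θ N τ s i).ownWork M T R i = q.work M T R i := by
      unfold LocalState.ownWork
      split_ifs with h0
      · rw [h0]; rfl
      · change (if (i : ℕ) = 0 then [] else if (i : ℕ) ≤ s then _ else _) = _
        rw [if_neg h0, if_pos (by lia)]
    rw [this]; rfl
  · rfl

/-- The state after the recording of the reward. -/
lemma addReward_localState {i : Fin M} {s : ℕ} (hs : q.step = s) {y : ℝ}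
    (hy : ∀ c, q.target M T R i = some c → y =
      inner ℝ ((q.design R).arm c) θ + N (τ + s) i ((q.design R).arm c)) :
    (q.localState T R θ N τ s i).addReward M T R i y =
      { q.localState T R θ N τ s i with
        sums := if (i : ℕ) = 0 then
            if s < (M - 1) + q.pullLen M T R then q.serverSum T R θ N τ (s + 1)
            else q.serverSum T R θ N τ s
          else q.localSum T R θ N τ i (min (s + 1 - (M - 1)) (q.pullLen M T R)) } := by
  unfold LocalState.addReward
  rw [target_localState q hs]
  have hi := i.2
  by_cases hst : M - 1 ≤ s ∧ s < (M - 1) + q.pullLen M T R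
  -- In the pulling stage exactly one further term enters the local sum; outside of it the truncated
  -- index does not move.
  · have hK : ∀ c, q.localSum T R θ N τ i (min (s + 1 - (M - 1)) (q.pullLen M T R)) c =
        q.localSum T R θ N τ i (min (s - (M - 1)) (q.pullLen M T R)) c +
        if q.target M T R i = some c then y else 0 := by
      intro c
      rw [min_eq_left (by lia), min_eq_left (by lia), Nat.sub_add_comm hst.1, localSum,
        Finset.sum_range_succ]
      congr 1
      have htar : q.target M T R i = q.pull M T R i (s - (M - 1)) := by
        unfold target; rw [hs, if_pos hst]
      rw [htar]
      split_ifs with h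
      · rw [hy c (htar.trans h)]
        have : τ + (M - 1) + (s - (M - 1)) = τ + s := by lia
        rw [this]
      · rfl
    have hserver : (i : ℕ) = 0 → ∀ c, q.serverSum T R θ N τ (s + 1) c =
        q.serverSum T R θ N τ s c + if q.target M T R i = some c then y else 0 := by
      intro h0 c
      unfold serverSum
      rw [← Finset.add_sum_erase _ _ (Finset.mem_univ i),
        ← Finset.add_sum_erase _ (fun i : Fin M => if (i : ℕ) = 0 then
          q.localSum T R θ N τ i (min (s - (M - 1)) (q.pullLen M T R)) c else _)
          (Finset.mem_univ i)]
      simp only [if_pos h0]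
      rw [hK c, add_assoc, add_assoc, add_comm (ite _ _ _)]
      congr 2
      refine Finset.sum_congr rfl fun j hj => ?_
      have hj0 : (j : ℕ) ≠ 0 := fun h =>
        Finset.ne_of_mem_erase hj (Fin.ext (h.trans h0.symm))
      rw [if_neg hj0, if_neg hj0, if_neg (by lia), if_neg (by lia)]
    rcases htar : q.target M T R i with _ | c
    · simp only [localState, htar, reduceCtorEq, if_false, add_zero] at hK hserver ⊢
      congr 1
      split_ifs with h0 h1
      · exact (funext (hserver h0)).symm
      · rfl
      · exact (funext hK).symm
    · simp only [localState, htar, Option.some.injEq] at hK hserver ⊢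
      congr 1
      funext c'
      by_cases hc : c' = c
      · subst hc
        rw [Function.update_self]
        split_ifs with h0 h1
        · rw [hserver h0, if_pos rfl]
        · exact absurd hst.2 h1
        · rw [hK, if_pos rfl]
      · rw [Function.update_of_ne hc]
        split_ifs with h0 h1
        · rw [hserver h0, if_neg (Ne.symm hc), add_zero]
        · rfl
        · rw [hK, if_neg (Ne.symm hc), add_zero]
  · have htar : q.target M T R i = none := by
      unfold target; rw [hs, if_neg hst]
    rw [htar]
    simp only [localState]
    congr 1
    split_ifs with h0 h1
    · funext c
      refine Finset.sum_congr rfl fun j _ => ?_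
      split_ifs with hj h2 h3 h3
      · have : s + 1 - (M - 1) = s - (M - 1) := by lia
        rw [this]
      · rfl
      · lia
      · lia
      · rfl
    · rfl
    · have : min (s + 1 - (M - 1)) (q.pullLen M T R) = min (s - (M - 1)) (q.pullLen M T R) := by
        lia
      rw [this]

/-- The message from agent `i` to agent `j`, in terms of the common part of the states. -/
lemma outbox_localState {i j : Fin M} {s : ℕ} :
    (q.localState T R θ N τ s i).outbox M T R i j =
      if (i : ℕ) = 0 ∧ s < M - 1 ∧ (j : ℕ) = s + 1 then some (.assign (q.work M T R j))
      else if (j : ℕ) = 0 ∧ 0 < (i : ℕ) ∧ s + 1 = (M - 1) + q.pullLen M T R + i then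
        some (.report ((q.work M T R i).map fun w =>
          q.localSum T R θ N τ i (q.pullLen M T R) w.1 / w.2))
      else if (i : ℕ) = 0 ∧ 0 < (j : ℕ) ∧ s + 1 = 2 * (M - 1) + q.pullLen M T R + j then
        some (.param (q.fit T R θ N τ))
      else none := by
  have hi := i.2
  have hj := j.2
  unfold LocalState.outbox
  have hp : (q.localState T R θ N τ s i).pullSteps M T R = q.pullLen M T R := rfl
  have hst : (q.localState T R θ N τ s i).step = s := rfl
  simp only [hp, hst]
  split_ifs with h1 h2 h3 h4 h5 h6 h7 <;> first | rfl | lia | skip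
  · have hne : ¬ (i : ℕ) = 0 := by lia
    have hle : (i : ℕ) ≤ s := by lia
    simp only [localState, if_neg hne, if_pos hle]
    rw [min_eq_right (by lia)]
  · congr 2
    unfold LocalState.fit fit
    simp only [localState, if_pos h5.1]
    rw [serverSum_eq_totalSum q (by lia)]
    rfl

/-- The message received by agent `i`, in terms of the common part of the states. -/
noncomputable def inbox (T : ℕ) (R : DesignRule d) (θ : Vec d) (N : ℕ → Fin M → Vec d → ℝ)
    (τ s : ℕ) (i : Fin M) : Option (Message d) :=
  (((q.localState T R θ N τ s i).source M T R i).bind fun j =>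
    if h : j < M then some (⟨j, h⟩ : Fin M) else none).bind fun j =>
      if j = i then none else (q.localState T R θ N τ s j).outbox M T R j i

lemma inbox_of_ne_zero {i : Fin M} {s : ℕ} (hi0 : (i : ℕ) ≠ 0) :
    q.inbox T R θ N τ s i = if s + 1 = i then some (.assign (q.work M T R i))
      else if s + 1 = 2 * (M - 1) + q.pullLen M T R + i then some (.param (q.fit T R θ N τ))
      else none := by
  have hi := i.2
  unfold inbox LocalState.source
  rw [if_neg hi0]
  simp only [Option.bind_some]
  rw [dif_pos (by lia), Option.bind_some, if_neg (fun h => hi0 (congrArg Fin.val h).symm),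
    outbox_localState]
  simp only [true_and]
  split_ifs <;> first | rfl | lia

/-- Before the reporting stage agent 0 does not listen; after it, the number computed by `source` is
at least M and belongs to no agent. -/
lemma inbox_zero_of_lt {i : Fin M} {s : ℕ} (hi0 : (i : ℕ) = 0)
    (hs : s < (M - 1) + q.pullLen M T R ∨ 2 * (M - 1) + q.pullLen M T R ≤ s) :
    q.inbox T R θ N τ s i = none := by
  have hi := i.2
  have hp : (q.localState T R θ N τ s i).pullSteps M T R = q.pullLen M T R := rfl
  have hst : (q.localState T R θ N τ s i).step = s := rfl
  unfold inbox LocalState.source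
  rw [if_pos hi0, hp, hst]
  split_ifs with h
  · simp only [Option.bind_some]
    rw [dif_neg (by lia)]
    rfl
  · rfl

lemma inbox_zero_of_mem {i j : Fin M} {s : ℕ} (hi0 : (i : ℕ) = 0) (hj : 0 < (j : ℕ))
    (hs : s + 1 = (M - 1) + q.pullLen M T R + j) :
    q.inbox T R θ N τ s i = some (.report ((q.work M T R j).map fun w =>
      q.localSum T R θ N τ j (q.pullLen M T R) w.1 / w.2)) := by
  have hj' := j.2
  have hp : (q.localState T R θ N τ s i).pullSteps M T R = q.pullLen M T R := rfl
  have hst : (q.localState T R θ N τ s i).step = s := rfl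
  unfold inbox LocalState.source
  rw [if_pos hi0, hp, hst, if_pos (by lia)]
  simp only [Option.bind_some]
  have he : s + 1 - (M - 1 + q.pullLen M T R) = j := by lia
  rw [dif_pos (by lia), Option.bind_some]
  simp only [he]
  rw [if_neg (fun h => by have := congrArg Fin.val h; simp only at this; lia), outbox_localState, if_neg (by lia),
    if_pos ⟨hi0, hj, hs⟩]

/-- The state after a time step, before the clock is advanced. -/
lemma receive_localState {i : Fin M} {s : ℕ} (hs : q.step = s)
    (hlen : s < q.len M T R) {y : ℝ}
    (hy : ∀ c, q.target M T R i = some c → y =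
      inner ℝ ((q.design R).arm c) θ + N (τ + s) i ((q.design R).arm c)) :
    (((q.localState T R θ N τ s i).addReward M T R i y).receive M T R
        (q.inbox T R θ N τ s i)) =
      { q.localState T R θ N τ (s + 1) i with step := s } := by
  rw [addReward_localState q hs hy]
  have hi := i.2
  have hlen' : s < 3 * (M - 1) + q.pullLen M T R := hlen
  by_cases hi0 : (i : ℕ) = 0
  · by_cases hst : s < (M - 1) + q.pullLen M T R ∨ 2 * (M - 1) + q.pullLen M T R ≤ s
    · rw [inbox_zero_of_lt q hi0 hst]
      simp only [LocalState.receive, localState, hi0, if_true]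
      congr 1
      split_ifs with h
      · rfl
      · rw [serverSum_eq_totalSum q (by lia), serverSum_eq_totalSum q (by lia)]
    · push Not at hst
      obtain ⟨j, hj⟩ : ∃ j : Fin M, (j : ℕ) = s + 1 - (M - 1 + q.pullLen M T R) :=
        ⟨⟨s + 1 - (M - 1 + q.pullLen M T R), by lia⟩, rfl⟩
      rw [inbox_zero_of_mem q hi0 (j := j) (by lia) (by lia)]
      simp only [LocalState.receive, LocalState.addReport, localState, hi0, if_true]
      rw [if_neg (by lia)]
      congr 1
      · funext c
        have hrep := sum_report (M := M) (n := (q.design R).size) (m := q.num M T R) j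
          (q.localSum T R θ N τ j (q.pullLen M T R)) (c := c) (fun h => q.localSum_eq_zero h)
        -- The report received in this step switches on the term of j alone; own pulls of agent 0
        -- are over by now.
        have hgoal : q.serverSum T R θ N τ s c + q.localSum T R θ N τ j (q.pullLen M T R) c =
            q.serverSum T R θ N τ (s + 1) c := by
          unfold serverSum
          rw [← Finset.add_sum_erase _ _ (Finset.mem_univ j),
            ← Finset.add_sum_erase _ (fun i : Fin M => if (i : ℕ) = 0 then
              q.localSum T R θ N τ i (min (s + 1 - (M - 1)) (q.pullLen M T R)) c else _)
              (Finset.mem_univ j)]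
          rw [if_neg (by lia), if_neg (by lia), if_neg (by lia), if_pos (by lia), zero_add,
            add_comm]
          congr 1
          refine Finset.sum_congr rfl fun j' hj' => ?_
          have hne : (j' : ℕ) ≠ j := fun h => Finset.ne_of_mem_erase hj' (Fin.ext h)
          split_ifs <;> first | rfl | lia | skip
          rw [min_eq_right (by lia), min_eq_right (by lia)]
        rw [← hgoal, ← hrep, hj]
        rfl
  · rw [inbox_of_ne_zero q hi0]
    split_ifs with h1 h2
    · simp only [LocalState.receive, localState, hi0, if_false]
      congr 1
      · rw [if_pos (by lia)]
      · rw [if_neg (by lia), if_neg (by lia)]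
    · simp only [LocalState.receive, localState, hi0, if_false]
      congr 1
      · split_ifs <;> first | rfl | lia
      · rw [if_pos (by lia)]
    · simp only [LocalState.receive, localState, hi0, if_false]
      congr 1
      · split_ifs <;> first | rfl | lia
      · split_ifs <;> first | rfl | lia

end Cur

/-! ### Number of pulls in a phase -/

section

/-- A lower bound for the total number of pulls in phase `l`. -/
noncomputable def budget (d M T l : ℕ) : ℝ := 600 * 4 ^ l * (d : ℝ) ^ 2 * Real.log (M * T)

lemma IsDesign.budget_le {d M T l : ℕ} {A : Finset (Vec d)} {δ : Design d}
    (h : IsDesign M T l A δ) :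
    budget d M T l ≤ ((∑ c ∈ Finset.range δ.size, pulls M T l δ c : ℕ) : ℝ) := by
  have h1 : budget d M T l =
      ∑ c ∈ Finset.range δ.size, 600 * 4 ^ l * (d : ℝ) ^ 2 * δ.weight c * Real.log (M * T) := by
    rw [← Finset.sum_mul, ← Finset.mul_sum, h.weight_sum, mul_one, budget]
  rw [h1, Nat.cast_sum]
  exact Finset.sum_le_sum fun c _ => Nat.le_ceil _

/-- Rounding up costs at most one extra pull per arm of the support. -/
lemma IsDesign.sum_pulls_le {d M T l : ℕ} {A : Finset (Vec d)} {δ : Design d}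
    (h : IsDesign M T l A δ) (hlog : 0 ≤ Real.log (M * T)) :
    ((∑ c ∈ Finset.range δ.size, pulls M T l δ c : ℕ) : ℝ) ≤ budget d M T l + δ.size := by
  have h1 : budget d M T l + δ.size =
      ∑ c ∈ Finset.range δ.size,
        (600 * 4 ^ l * (d : ℝ) ^ 2 * δ.weight c * Real.log (M * T) + 1) := by
    rw [Finset.sum_add_distrib, ← Finset.sum_mul, ← Finset.mul_sum, h.weight_sum, mul_one, budget]
    simp
  rw [h1, Nat.cast_sum]
  refine Finset.sum_le_sum fun c hc => ?_
  have := h.weight_pos c (Finset.mem_range.1 hc)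
  exact (Nat.ceil_lt_add_one (by positivity)).le

/-! ### The dynamics of the protocol -/

namespace Cur

variable {d M : ℕ} (T : ℕ) (R : DesignRule d) {D : Finset (Vec d)}
variable (θ : Vec d) (N : ℕ → Fin M → Vec d → ℝ)

/-- The transition in time step `t`. -/
noncomputable def next (t : ℕ) (q : Cur D) : Cur D :=
  if q.step + 1 < q.len M T R then { q with step := q.step + 1 }
  else
    { phase := q.phase + 1
      step := 0
      active := eliminate q.phase q.active (q.fit T R θ N (t - q.step))
      sub := eliminate_subset.trans q.sub
      ne := eliminate_nonempty q.ne }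

end Cur

variable {d M : ℕ} (T : ℕ) (R : DesignRule d) {D : Finset (Vec d)} (hD : D.Nonempty)
variable (θ : Vec d) (N : ℕ → Fin M → Vec d → ℝ)

/-- The common part of the local states at time `t`. -/
noncomputable def cur : ℕ → Cur D
  | 0 => ⟨1, 0, D, subset_rfl, hD⟩
  | t + 1 => (cur t).next T R θ N t

variable {T R θ N}

lemma DesignRule.Valid.isDesign (hR : R.Valid M T) (q : Cur D) :
    IsDesign M T q.phase q.active (q.design R) := hR _ _ q.ne

lemma budget_le_mul_pullLen (hR : R.Valid M T) (hM : 1 ≤ M) (q : Cur D) :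
    budget d M T q.phase ≤ M * q.pullLen M T R := by
  refine (hR.isDesign q).budget_le.trans ?_
  exact_mod_cast sum_le_mul_perAgent hM _ _

lemma budget_pos (hd : 0 < d) (hMT : 1 < M * T) (l : ℕ) : 0 < budget d M T l := by
  have : 0 < Real.log (M * T) := Real.log_pos (by exact_mod_cast hMT)
  have : (0 : ℝ) < d := by exact_mod_cast hd
  unfold budget
  positivity

lemma pullLen_pos (hR : R.Valid M T) (hd : 0 < d) (hMT : 1 < M * T) (q : Cur D) :
    0 < q.pullLen M T R := by
  have hM : 1 ≤ M := by by_contra h; simp [show M = 0 by lia] at hMT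
  have h1 := (budget_pos hd hMT q.phase).trans_le (budget_le_mul_pullLen hR hM q)
  by_contra! h
  simp [show q.pullLen M T R = 0 by lia] at h1

lemma len_pos (hR : R.Valid M T) (hd : 0 < d) (hMT : 1 < M * T) (q : Cur D) :
    0 < q.len M T R := by
  have := pullLen_pos hR hd hMT q
  unfold Cur.len
  lia

lemma cur_step (hlen : ∀ q : Cur D, 0 < q.len M T R) (t : ℕ) :
    (cur T R hD θ N t).step ≤ t ∧ (cur T R hD θ N t).step < (cur T R hD θ N t).len M T R := by
  induction t with
  | zero => exact ⟨le_rfl, hlen _⟩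
  | succ t ih =>
    change ((cur T R hD θ N t).next T R θ N t).step ≤ t + 1 ∧
      ((cur T R hD θ N t).next T R θ N t).step <
      ((cur T R hD θ N t).next T R θ N t).len M T R
    unfold Cur.next
    split_ifs with h
    · exact ⟨Nat.succ_le_succ ih.1, h⟩
    · exact ⟨Nat.zero_le _, hlen _⟩

lemma cur_succ_of_lt {t : ℕ}
    (h : (cur T R hD θ N t).step + 1 < (cur T R hD θ N t).len M T R) :
    cur T R hD θ N (t + 1) =
      { cur T R hD θ N t with step := (cur T R hD θ N t).step + 1 } := by
  change (cur T R hD θ N t).next T R θ N t = _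
  unfold Cur.next
  rw [if_pos h]

/-- The phase at time `t` has started `step` time steps before. -/
lemma cur_sub_step (t : ℕ) :
    cur T R hD θ N (t - (cur T R hD θ N t).step) = { cur T R hD θ N t with step := 0 } := by
  induction t with
  | zero => rfl
  | succ t ih =>
    by_cases h : (cur T R hD θ N t).step + 1 < (cur T R hD θ N t).len M T R
    · rw [cur_succ_of_lt hD h]
      simp only [Nat.add_sub_add_right]
      exact ih
    · have h0 : (cur T R hD θ N (t + 1)).step = 0 := by
        change ((cur T R hD θ N t).next T R θ N t).step = 0
        unfold Cur.next
        rw [if_neg h]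
      rw [h0, Nat.sub_zero]
      generalize cur T R hD θ N (t + 1) = q at h0
      cases q
      simp only at h0
      rw [h0]

lemma Cur.localState_zero (q : Cur D) {τ : ℕ} (i : Fin M) :
    q.localState T R θ N τ 0 i = ⟨q.phase, 0, q.active, [], 0, 0⟩ := by
  have hlocal : ∀ (j : Fin M) (c : ℕ),
      q.localSum T R θ N τ j (min (0 - (M - 1)) (q.pullLen M T R)) c = 0 := by
    intro j c
    rw [Nat.zero_sub, Nat.zero_min]; rfl
  unfold localState
  congr 1
  · split_ifs with h0 h1 <;> first | rfl | lia
  · split_ifs with h0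
    · funext c
      refine Finset.sum_eq_zero fun j _ => ?_
      split_ifs with h1 h2
      · exact hlocal j c
      · lia
      · rfl
    · exact funext (hlocal i)
  · exact if_neg (by lia)

/-- At the end of a phase agent 0 holds all sums and every other agent has received the estimate
computed from the same sums. Hence all agents eliminate with one vector and remain synchronized. -/
lemma advance_localState {q : Cur D} {i : Fin M} {s t : ℕ} (hs : q.step = s)
    (hlen : s < q.len M T R) :
    LocalState.advance M T R { q.localState T R θ N (t - s) (s + 1) i with step := s } i =
      (q.next T R θ N t).localState T R θ N (t + 1 - (q.next T R θ N t).step)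
        (q.next T R θ N t).step i := by
  have hi := i.2
  unfold LocalState.advance
  change (if s + 1 < q.len M T R then _ else _) = _
  subst hs
  by_cases h : q.step + 1 < q.len M T R
  · have hnext : q.next T R θ N t = { q with step := q.step + 1 } := if_pos h
    rw [if_pos h, hnext]
    simp only [Nat.add_sub_add_right]
    rfl
  · have hnext : q.next T R θ N t = ⟨q.phase + 1, 0,
        eliminate q.phase q.active (q.fit T R θ N (t - q.step)),
        eliminate_subset.trans q.sub, eliminate_nonempty q.ne⟩ := if_neg h
    rw [if_neg h, hnext]
    have hs' : q.step + 1 = 3 * (M - 1) + q.pullLen M T R := le_antisymm hlen (not_lt.1 h)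
    have hest : (if (i : ℕ) = 0 then
        LocalState.fit M T R { q.localState T R θ N (t - q.step) (q.step + 1) i with step := q.step }
        else (q.localState T R θ N (t - q.step) (q.step + 1) i).est) =
        q.fit T R θ N (t - q.step) := by
      by_cases h0 : (i : ℕ) = 0
      · rw [if_pos h0]
        unfold LocalState.fit Cur.fit
        simp only [Cur.localState, if_pos h0]
        rw [q.serverSum_eq_totalSum (by lia)]
        rfl
      · rw [if_neg h0]
        simp only [Cur.localState]
        rw [if_pos ⟨h0, by lia⟩]
    change LocalState.mk (q.phase + 1) 0 (eliminate q.phase q.active (if (i : ℕ) = 0 then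
        LocalState.fit M T R { q.localState T R θ N (t - q.step) (q.step + 1) i with step := q.step }
        else (q.localState T R θ N (t - q.step) (q.step + 1) i).est)) [] 0 0 = _
    rw [hest]
    exact (Cur.localState_zero (T := T) (R := R) (θ := θ) (N := N) (τ := t + 1) (D := D)
      ⟨q.phase + 1, 0, eliminate q.phase q.active (q.fit T R θ N (t - q.step)),
        eliminate_subset.trans q.sub, eliminate_nonempty q.ne⟩ i).symm

variable {free : ℕ → Fin M → Vec d}

/-- The bridge from the message-passing protocol to the recursion `cur`. The right side is free of
`free`: arbitrary pulls leave no trace in the states. -/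
lemma state_eq (hlen : ∀ q : Cur D, 0 < q.len M T R) (t : ℕ) (i : Fin M) :
    (delb M T R D).state θ N free t i =
      (cur T R hD θ N t).localState T R θ N (t - (cur T R hD θ N t).step)
        (cur T R hD θ N t).step i := by
  induction t generalizing i with
  | zero =>
    exact ((cur T R hD θ N 0).localState_zero i).symm
  | succ t ih =>
    obtain ⟨hst, hsl⟩ := cur_step (N := N) (θ := θ) hD hlen t
    simp only [P2PProtocol.state]
    set q := cur T R hD θ N t with hq
    have hih : (delb M T R D).state θ N free t =
        fun i => q.localState T R θ N (t - q.step) q.step i := funext ih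
    rw [hih]
    change LocalState.advance M T R (LocalState.receive M T R (LocalState.addReward M T R
      (q.localState T R θ N (t - q.step) q.step i) i _)
      (q.inbox T R θ N (t - q.step) q.step i)) i = _
    rw [q.receive_localState rfl hsl, advance_localState rfl hsl]
    · rfl
    · intro c hc
      have hact : ((delb M T R D).act i
          (q.localState T R θ N (t - q.step) q.step i)).getD (free t i) =
          (q.design R).arm c := by
        change (Option.map _ (LocalState.target M T R
          (q.localState T R θ N (t - q.step) q.step i) i)).getD _ = _
        rw [q.target_localState rfl, hc]
        rfl
      rw [hact, Nat.sub_add_cancel hst]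

/-- The arm pulled by agent `i` at time `t`. -/
lemma action_eq (hlen : ∀ q : Cur D, 0 < q.len M T R) (t : ℕ) (i : Fin M) :
    (delb M T R D).action θ N free t i =
      (((cur T R hD θ N t).target M T R i).map ((cur T R hD θ N t).design R).arm).getD
        (free t i) := by
  unfold P2PProtocol.action
  rw [state_eq hD hlen]
  change (Option.map _ (LocalState.target M T R _ i)).getD _ = _
  rw [Cur.target_localState _ rfl]
  rfl

/-- Number of packets which are sent in a time step. -/
noncomputable def Cur.cost (M T : ℕ) (R : DesignRule d) (q : Cur D) : ℕ :=
  ∑ i : Fin M, ∑ j : Fin M,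
    if (i : ℕ) = 0 ∧ q.step < M - 1 ∧ (j : ℕ) = q.step + 1 then 2 * (q.work M T R j).length
    else if (j : ℕ) = 0 ∧ 0 < (i : ℕ) ∧ q.step + 1 = (M - 1) + q.pullLen M T R + i then
      (q.work M T R i).length
    else if (i : ℕ) = 0 ∧ 0 < (j : ℕ) ∧ q.step + 1 = 2 * (M - 1) + q.pullLen M T R + j then d
    else 0

lemma commCost_eq (hlen : ∀ q : Cur D, 0 < q.len M T R) (t : ℕ) :
    (delb M T R D).commCost θ N free t =
      ∑ t' ∈ Finset.range t, (cur T R hD θ N t').cost M T R := by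
  refine Finset.sum_congr rfl fun t' _ => Finset.sum_congr rfl fun i _ =>
    Finset.sum_congr rfl fun j _ => ?_
  rw [state_eq hD hlen]
  change (if j = i then 0 else (Option.map _ (LocalState.outbox M T R _ i j)).getD 0) = _
  rw [Cur.outbox_localState]
  split_ifs with h h1 h2 h3 h4 h5 h6 <;> first | rfl | (subst h; lia) | skip
  simp [Message.size]

/-! ### The dynamics depends on the past only, and measurably -/

lemma Cur.localSum_congr (q : Cur D) {N' : ℕ → Fin M → Vec d → ℝ} {τ K : ℕ} {i : Fin M} {c : ℕ}
    (h : ∀ k < K, N (τ + (M - 1) + k) i = N' (τ + (M - 1) + k) i) :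
    q.localSum T R θ N τ i K c = q.localSum T R θ N' τ i K c :=
  Finset.sum_congr rfl fun k hk => by rw [h k (Finset.mem_range.1 hk)]

/-- Non-anticipation: the estimate used at a transition involves only noise of the pulling stage
that has just ended. This is the source of independence between a start state and the noise of its
phase. -/
lemma cur_congr (hlen : ∀ q : Cur D, 0 < q.len M T R) {N' : ℕ → Fin M → Vec d → ℝ} {t : ℕ}
    (h : ∀ t' < t, N t' = N' t') : cur T R hD θ N t = cur T R hD θ N' t := by
  induction t with
  | zero => rfl
  | succ t ih =>
    have ih' := ih fun t' ht' => h t' (by lia)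
    obtain ⟨hst, hsl⟩ := cur_step (N := N) (θ := θ) hD hlen t
    change (cur T R hD θ N t).next T R θ N t = (cur T R hD θ N' t).next T R θ N' t
    rw [← ih']
    set q := cur T R hD θ N t
    unfold Cur.next
    split_ifs with h1
    · rfl
    · have : q.fit T R θ N (t - q.step) = q.fit T R θ N' (t - q.step) := by
        unfold Cur.fit
        congr 1
        funext c
        refine Finset.sum_congr rfl fun i _ => q.localSum_congr fun k hk => ?_
        unfold Cur.len at h1 hsl
        rw [h _ (by lia)]
      simp only [this]

/-- There are only countably many common states, since active sets are subsets of the finite D. So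
the discrete σ-algebra suffices and one can sum over states instead of conditioning. -/
instance : MeasurableSpace (Cur D) := ⊤

instance : DiscreteMeasurableSpace (Cur D) := ⟨fun _ => trivial⟩

instance : Countable (Cur D) := by
  have : Function.Injective fun q : Cur D =>
      (q.phase, q.step, (⟨q.active, Finset.mem_powerset.2 q.sub⟩ : D.powerset)) := by
    rintro ⟨l, s, A, h1, h2⟩ ⟨l', s', A', h1', h2'⟩ h
    simp only [Prod.mk.injEq, Subtype.mk.injEq] at h
    obtain ⟨rfl, rfl, rfl⟩ := h
    rfl
  exact this.countable

lemma measurable_noise (t : ℕ) (i : Fin M) (x : Vec d) :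
    Measurable fun N : ℕ → Fin M → Vec d → ℝ => N t i x :=
  (measurable_pi_apply x).comp ((measurable_pi_apply i).comp (measurable_pi_apply t))

lemma Cur.measurable_totalSum (q : Cur D) (τ c : ℕ) :
    Measurable fun N : ℕ → Fin M → Vec d → ℝ => q.totalSum T R θ N τ c := by
  unfold totalSum localSum
  refine Finset.measurable_sum _ fun i _ => Finset.measurable_sum _ fun k _ => ?_
  split_ifs
  · exact measurable_const.add (measurable_noise _ _ _)
  · exact measurable_const

end

/-! ### Least squares -/

namespace Design

variable {d : ℕ} (δ : Design d)

lemma inner_moment (w : ℕ → ℝ) (u y : Vec d) :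
    inner ℝ y (δ.moment w u) =
      ∑ c ∈ Finset.range δ.size, w c * inner ℝ (δ.arm c) u * inner ℝ (δ.arm c) y := by
  unfold moment
  rw [inner_sum]
  refine Finset.sum_congr rfl fun c _ => ?_
  rw [real_inner_smul_right, real_inner_comm y]

lemma inner_moment_comm (w : ℕ → ℝ) (u y : Vec d) :
    inner ℝ y (δ.moment w u) = inner ℝ (δ.moment w y) u := by
  rw [real_inner_comm u, inner_moment, inner_moment]
  exact Finset.sum_congr rfl fun c _ => by ring

/-- The moment operator as a linear map. -/
noncomputable def momentMap (w : ℕ → ℝ) : Vec d →ₗ[ℝ] Vec d where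
  toFun := δ.moment w
  map_add' u v := by
    unfold moment
    rw [← Finset.sum_add_distrib]
    refine Finset.sum_congr rfl fun c _ => ?_
    rw [inner_add_right, mul_add, add_smul]
  map_smul' a u := by
    unfold moment
    rw [Finset.smul_sum]
    refine Finset.sum_congr rfl fun c _ => ?_
    rw [real_inner_smul_right, smul_smul, RingHom.id_apply, mul_left_comm]

end Design

section LeastSquares

variable {d M T l : ℕ} {A : Finset (Vec d)} {δ : Design d} {m : ℕ → ℝ}

lemma IsDesign.sum_smul_arm_mem (h : IsDesign M T l A δ) (a : ℕ → ℝ) :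
    ∑ c ∈ Finset.range δ.size, a c • δ.arm c ∈ Submodule.span ℝ (A : Set (Vec d)) :=
  Submodule.sum_mem _ fun c hc => Submodule.smul_mem _ _
    (Submodule.subset_span (h.arm_mem c (Finset.mem_range.1 hc)))

/-- A vector in the kernel is orthogonal to all arms of the design. By `g_le` these arms span A, so
a kernel vector in span A vanishes, and injectivity gives surjectivity in finite dimension. -/
lemma IsDesign.exists_moment_eq (h : IsDesign M T l A δ) (hm : ∀ c < δ.size, 0 < m c)
    {y : Vec d} (hy : y ∈ Submodule.span ℝ (A : Set (Vec d))) :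
    ∃ u ∈ Submodule.span ℝ (A : Set (Vec d)), δ.moment m u = y := by
  set E := Submodule.span ℝ (A : Set (Vec d))
  have hE : ∀ u ∈ E, δ.momentMap m u ∈ E := fun u _ => h.sum_smul_arm_mem _
  let L := (δ.momentMap m).restrict hE
  have hinj : Function.Injective L := by
    rw [← LinearMap.ker_eq_bot, LinearMap.ker_eq_bot']
    rintro ⟨u, hu⟩ hLu
    have h0 : δ.moment m u = 0 := congrArg Subtype.val hLu
    have h1 : ∑ c ∈ Finset.range δ.size, m c * inner ℝ (δ.arm c) u ^ 2 = 0 := by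
      have := δ.inner_moment m u u
      rw [h0, inner_zero_right] at this
      rw [this]
      exact Finset.sum_congr rfl fun c _ => by ring
    have h2 : ∀ c ∈ Finset.range δ.size, inner ℝ (δ.arm c) u = 0 := by
      intro c hc
      have hc' := hm c (Finset.mem_range.1 hc)
      have := (Finset.sum_eq_zero_iff_of_nonneg fun c hc => by
        have := hm c (Finset.mem_range.1 hc)
        positivity).1 h1 c hc
      simpa [hc'.ne'] using this
    have h3 : ∀ x ∈ E, inner ℝ x u = 0 := by
      intro x hx
      induction hx using Submodule.span_induction with
      | mem x hx =>
        obtain ⟨v, -, rfl, -⟩ := h.g_le x hx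
        rw [real_inner_comm, Design.inner_moment]
        exact Finset.sum_eq_zero fun c hc => by rw [h2 c hc, mul_zero]
      | zero => exact inner_zero_left _
      | add x y _ _ hx hy => rw [inner_add_left, hx, hy, add_zero]
      | smul a x _ hx => rw [real_inner_smul_left, hx, mul_zero]
    exact Subtype.ext (inner_self_eq_zero.1 (h3 u hu))
  obtain ⟨u, hu⟩ := LinearMap.injective_iff_surjective.1 hinj ⟨y, hy⟩
  exact ⟨u, u.2, congrArg Subtype.val hu⟩

/-- The confidence width of an arm. -/
lemma IsDesign.leverage_le (h : IsDesign M T l A δ) {κ : ℝ} (hκ : 0 < κ)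
    (hm : ∀ c < δ.size, κ * δ.weight c ≤ m c) {x u : Vec d} (hx : x ∈ A)
    (hu : δ.moment m u = x) :
    ∑ c ∈ Finset.range δ.size, m c * inner ℝ (δ.arm c) u ^ 2 ≤ 2 * d / κ := by
  obtain ⟨v, -, hv, hle⟩ := h.g_le x hx
  set S := ∑ c ∈ Finset.range δ.size, m c * inner ℝ (δ.arm c) u ^ 2 with hS
  have hS1 : S = inner ℝ x u := by
    rw [real_inner_comm, ← hu, Design.inner_moment]
    exact Finset.sum_congr rfl fun c _ => by ring
  have h1 : S = ∑ c ∈ Finset.range δ.size,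
      (√(δ.weight c) * inner ℝ (δ.arm c) v) * (√(δ.weight c) * inner ℝ (δ.arm c) u) := by
    rw [hS1, ← hv, real_inner_comm, Design.inner_moment]
    refine Finset.sum_congr rfl fun c hc => ?_
    have := Real.mul_self_sqrt (h.weight_pos c (Finset.mem_range.1 hc)).le
    linear_combination (-inner ℝ (δ.arm c) v * inner ℝ (δ.arm c) u) * this
  have h2 : ∑ c ∈ Finset.range δ.size, (√(δ.weight c) * inner ℝ (δ.arm c) v) ^ 2 ≤ 2 * d := by
    refine le_trans (le_of_eq ?_) hle
    conv_rhs => rw [real_inner_comm, ← hv, Design.inner_moment]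
    refine Finset.sum_congr rfl fun c hc => ?_
    rw [mul_pow, Real.sq_sqrt (h.weight_pos c (Finset.mem_range.1 hc)).le]
    ring
  have h3 : κ * ∑ c ∈ Finset.range δ.size, (√(δ.weight c) * inner ℝ (δ.arm c) u) ^ 2 ≤ S := by
    rw [Finset.mul_sum]
    refine Finset.sum_le_sum fun c hc => ?_
    rw [mul_pow, Real.sq_sqrt (h.weight_pos c (Finset.mem_range.1 hc)).le, ← mul_assoc]
    exact mul_le_mul_of_nonneg_right (hm c (Finset.mem_range.1 hc)) (sq_nonneg _)
  -- Cauchy–Schwarz for the form of V(π) between v = V(π)⁻¹ x and u gives S² ≤ 2d · Q, while κ Q ≤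
  -- S; together S ≤ 2d/κ.
  have hCS := Finset.sum_mul_sq_le_sq_mul_sq (Finset.range δ.size)
    (fun c => √(δ.weight c) * inner ℝ (δ.arm c) v)
    (fun c => √(δ.weight c) * inner ℝ (δ.arm c) u)
  rw [← h1] at hCS
  set Q := ∑ c ∈ Finset.range δ.size, (√(δ.weight c) * inner ℝ (δ.arm c) u) ^ 2
  have hQ : 0 ≤ Q := Finset.sum_nonneg fun _ _ => sq_nonneg _
  have hS0 : 0 ≤ S := (mul_nonneg hκ.le hQ).trans h3
  rw [le_div_iff₀ hκ]
  rcases hS0.eq_or_lt with h0 | h0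
  · rw [← h0]; simp
  · have h4 : S ^ 2 ≤ 2 * d * Q := hCS.trans (mul_le_mul_of_nonneg_right h2 hQ)
    have h5 : S * (S * κ) ≤ S * (2 * d) := by
      have : (0 : ℝ) ≤ 2 * d := by positivity
      nlinarith
    exact le_of_mul_le_mul_left h5 h0

/-- The moment operator is symmetric, so it can be moved from u to the estimate, where the normal
equations apply. -/
lemma IsDesign.inner_estimate (h : IsDesign M T l A δ) {m : ℕ → ℕ} (hm : ∀ c < δ.size, 0 < m c)
    (sums : ℕ → ℝ) {x u : Vec d} (hx : δ.moment (fun c => (m c : ℝ)) u = x) :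
    inner ℝ (estimate A δ m sums) x =
      ∑ c ∈ Finset.range δ.size, sums c * inner ℝ (δ.arm c) u := by
  have hm' : ∀ c < δ.size, (0 : ℝ) < m c := fun c hc => by exact_mod_cast hm c hc
  have hex := h.exists_moment_eq hm' (h.sum_smul_arm_mem fun c => (m c : ℝ) * (sums c / m c))
  have hest : δ.moment (fun c => (m c : ℝ)) (estimate A δ m sums) =
      ∑ c ∈ Finset.range δ.size, ((m c : ℝ) * (sums c / m c)) • δ.arm c := by
    unfold estimate
    simp only
    rw [dif_pos hex]
    exact hex.choose_spec.2
  rw [← hx, Design.inner_moment_comm, hest, sum_inner]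
  refine Finset.sum_congr rfl fun c hc => ?_
  rw [real_inner_smul_left, mul_div_cancel₀ _ (hm' c (Finset.mem_range.1 hc)).ne']

end LeastSquares

/-! ### The error of the estimate as a weighted sum of noises -/

namespace Cur

variable {d M T : ℕ} {R : DesignRule d} {D : Finset (Vec d)} (q : Cur D)
variable (θ : Vec d) (N : ℕ → Fin M → Vec d → ℝ) (τ : ℕ)

variable (T R) in
/-- The noise of the estimate in the direction `u`. -/
noncomputable def noiseSum (u : Vec d) (N : ℕ → Fin M → Vec d → ℝ) (τ : ℕ) : ℝ :=
  ∑ i : Fin M, ∑ k ∈ Finset.range (q.pullLen M T R), (q.pull M T R i k).elim 0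
    fun c => inner ℝ ((q.design R).arm c) u * N (τ + (M - 1) + k) i ((q.design R).arm c)

lemma pull_lt {j k c : ℕ} (h : q.pull M T R j k = some c) : c < (q.design R).size :=
  lt_of_mem_expand_assignment (List.mem_of_getElem? h)

lemma sum_pull {V : Type*} [AddCommMonoid V] (hM : 1 ≤ M) (g : ℕ → V) :
    ∑ i : Fin M, ∑ k ∈ Finset.range (q.pullLen M T R), (q.pull M T R i k).elim 0 g =
      ∑ c ∈ Finset.range (q.design R).size, q.num M T R c • g c := by
  rw [← sum_assigned hM g, Finset.sum_range]
  rfl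

lemma sum_totalSum_mul (a : ℕ → ℝ) :
    ∑ c ∈ Finset.range (q.design R).size, q.totalSum T R θ N τ c * a c =
      ∑ i : Fin M, ∑ k ∈ Finset.range (q.pullLen M T R), (q.pull M T R i k).elim 0
        fun c => (inner ℝ ((q.design R).arm c) θ +
          N (τ + (M - 1) + k) i ((q.design R).arm c)) * a c := by
  unfold totalSum localSum
  simp only [Finset.sum_mul]
  rw [Finset.sum_comm]
  refine Finset.sum_congr rfl fun i _ => ?_
  rw [Finset.sum_comm]
  refine Finset.sum_congr rfl fun k _ => ?_
  rcases hp : q.pull M T R i k with _ | c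
  · simp
  · have hc := q.pull_lt hp
    simp only [Option.some.injEq, Option.elim_some, ite_mul, zero_mul]
    rw [Finset.sum_ite_eq, if_pos (Finset.mem_range.2 hc)]

lemma num_pos (hR : R.Valid M T) (hd : 0 < d) (hMT : 1 < M * T) :
    ∀ c < (q.design R).size, 0 < q.num M T R c := by
  intro c hc
  have h1 := (hR.isDesign q).weight_pos c hc
  have : 0 < Real.log (M * T) := Real.log_pos (by exact_mod_cast hMT)
  have : (0 : ℝ) < d := by exact_mod_cast hd
  exact Nat.ceil_pos.2 (by positivity)

lemma inner_fit (hR : R.Valid M T) (hd : 0 < d) (hMT : 1 < M * T) {x u : Vec d}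
    (hu : (q.design R).moment (fun c => (q.num M T R c : ℝ)) u = x) :
    inner ℝ (q.fit T R θ N τ) x =
      ∑ c ∈ Finset.range (q.design R).size,
        q.totalSum T R θ N τ c * inner ℝ ((q.design R).arm c) u :=
  (hR.isDesign q).inner_estimate (q.num_pos hR hd hMT) _ hu

/-- Least squares is unbiased: the mean rewards contribute ⟨θ, V u⟩ = ⟨θ, x⟩ exactly, and only the
noise remains. -/
lemma inner_fit_sub (hR : R.Valid M T) (hd : 0 < d) (hMT : 1 < M * T) {x u : Vec d}
    (hu : (q.design R).moment (fun c => (q.num M T R c : ℝ)) u = x) :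
    inner ℝ (q.fit T R θ N τ - θ) x = q.noiseSum T R u N τ := by
  have hM : 1 ≤ M := by by_contra h; simp [show M = 0 by lia] at hMT
  have h1 : inner ℝ θ x = ∑ i : Fin M, ∑ k ∈ Finset.range (q.pullLen M T R),
      (q.pull M T R i k).elim 0
        fun c => inner ℝ ((q.design R).arm c) θ * inner ℝ ((q.design R).arm c) u := by
    rw [sum_pull q hM, ← hu, Design.inner_moment]
    refine Finset.sum_congr rfl fun c _ => ?_
    rw [nsmul_eq_mul]
    ring
  rw [inner_sub_left, inner_fit q θ N τ hR hd hMT hu, sum_totalSum_mul, h1, noiseSum,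
    ← Finset.sum_sub_distrib]
  refine Finset.sum_congr rfl fun i _ => ?_
  rw [← Finset.sum_sub_distrib]
  refine Finset.sum_congr rfl fun k _ => ?_
  cases q.pull M T R i k with
  | none => simp
  | some c => simp only [Option.elim_some]; ring

lemma exists_moment_num_eq (hR : R.Valid M T) (hd : 0 < d) (hMT : 1 < M * T) {x : Vec d}
    (hx : x ∈ q.active) : ∃ u, (q.design R).moment (fun c => (q.num M T R c : ℝ)) u = x := by
  obtain ⟨u, -, hu⟩ := (hR.isDesign q).exists_moment_eq (m := fun c => (q.num M T R c : ℝ))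
    (fun c hc => by exact_mod_cast q.num_pos hR hd hMT c hc) (Submodule.subset_span hx)
  exact ⟨u, hu⟩

/-! ### Measurability -/

/-- The estimate is defined by choice, but its inner products with active arms are explicit linear
functions of the reward sums, and elimination uses nothing else. -/
lemma measurable_inner_fit (hR : R.Valid M T) (hd : 0 < d) (hMT : 1 < M * T) {x : Vec d}
    (hx : x ∈ q.active) :
    Measurable fun N : ℕ → Fin M → Vec d → ℝ => inner ℝ (q.fit T R θ N τ) x := by
  obtain ⟨u, hu⟩ := q.exists_moment_num_eq hR hd hMT hx
  simp only [q.inner_fit θ _ τ hR hd hMT hu]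
  exact Finset.measurable_sum _ fun c _ => (q.measurable_totalSum τ c).mul_const _

lemma measurable_next (hR : R.Valid M T) (hd : 0 < d) (hMT : 1 < M * T) (t : ℕ) :
    Measurable fun N : ℕ → Fin M → Vec d → ℝ => q.next T R θ N t := by
  classical
  refine measurable_to_countable' fun q' => ?_
  by_cases h : q.step + 1 < q.len M T R
  · have : ∀ N : ℕ → Fin M → Vec d → ℝ, q.next T R θ N t = { q with step := q.step + 1 } :=
      fun N => if_pos h
    simp only [this]
    exact measurable_const (measurableSet_singleton q')
  -- A given next active set is described by finitely many inequalities between these inner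
  -- products.
  · have hpre : (fun N : ℕ → Fin M → Vec d → ℝ => q.next T R θ N t) ⁻¹' {q'} =
        if q'.phase = q.phase + 1 ∧ q'.step = 0 ∧ q'.active ⊆ q.active then
          ⋂ x ∈ q.active, {N | x ∈ q'.active ↔ ∀ b ∈ q.active,
            inner ℝ (q.fit T R θ N (t - q.step)) b - inner ℝ (q.fit T R θ N (t - q.step)) x ≤
              2 * (1 / 2) ^ q.phase}
        else ∅ := by
      ext N
      have hnext : q.next T R θ N t = ⟨q.phase + 1, 0,
        eliminate q.phase q.active (q.fit T R θ N (t - q.step)),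
        eliminate_subset.trans q.sub, eliminate_nonempty q.ne⟩ := if_neg h
      simp only [Set.mem_preimage, hnext, Set.mem_singleton_iff]
      rcases q' with ⟨l', s', A', h1', h2'⟩
      simp only [Cur.mk.injEq]
      have hE : eliminate q.phase q.active (q.fit T R θ N (t - q.step)) = A' ↔
          A' ⊆ q.active ∧ ∀ x ∈ q.active, (x ∈ A' ↔ ∀ b ∈ q.active,
            inner ℝ (q.fit T R θ N (t - q.step)) b - inner ℝ (q.fit T R θ N (t - q.step)) x ≤
              2 * (1 / 2) ^ q.phase) := by
        constructor
        · rintro rfl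
          refine ⟨eliminate_subset, fun x hx => ?_⟩
          simp only [eliminate, Finset.mem_filter, hx, true_and, inner_sub_right]
        · rintro ⟨hsub, hiff⟩
          ext x
          simp only [eliminate, Finset.mem_filter, inner_sub_right]
          exact ⟨fun hx => (hiff x hx.1).2 hx.2, fun hx => ⟨hsub hx, (hiff x (hsub hx)).1 hx⟩⟩
      split_ifs with hq
      · simp only [hE, Set.mem_iInter, Set.mem_ofPred_eq, hq.1, hq.2.1, hq.2.2, true_and]
      · simp only [Set.mem_empty_iff_false, iff_false]
        rintro ⟨rfl, rfl, hA⟩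
        exact hq ⟨rfl, rfl, (hE.1 hA).1⟩
    rw [hpre]
    split_ifs
    · refine Finset.measurableSet_biInter _ fun x hx => ?_
      refine MeasurableSet.iff (MeasurableSet.const _) ?_
      have : {N : ℕ → Fin M → Vec d → ℝ | ∀ b ∈ q.active,
          inner ℝ (q.fit T R θ N (t - q.step)) b - inner ℝ (q.fit T R θ N (t - q.step)) x ≤
            2 * (1 / 2) ^ q.phase} = ⋂ b ∈ q.active, {N : ℕ → Fin M → Vec d → ℝ |
          inner ℝ (q.fit T R θ N (t - q.step)) b - inner ℝ (q.fit T R θ N (t - q.step)) x ≤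
            2 * (1 / 2) ^ q.phase} := by ext; simp
      rw [this]
      refine Finset.measurableSet_biInter _ fun b hb => measurableSet_le ?_ measurable_const
      exact (q.measurable_inner_fit θ _ hR hd hMT hb).sub
        (q.measurable_inner_fit θ _ hR hd hMT hx)
    · exact MeasurableSet.empty

end Cur

lemma measurable_cur {d M T : ℕ} {R : DesignRule d} {D : Finset (Vec d)} (hD : D.Nonempty)
    (θ : Vec d) (hR : R.Valid M T) (hd : 0 < d) (hMT : 1 < M * T) (t : ℕ) :
    Measurable fun N : ℕ → Fin M → Vec d → ℝ => cur T R hD θ N t := by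
  induction t with
  | zero => exact measurable_const
  | succ t ih =>
    have h1 : Measurable fun p : (ℕ → Fin M → Vec d → ℝ) × Cur D => p.2.next T R θ p.1 t :=
      measurable_from_prod_countable_left fun q => q.measurable_next θ hR hd hMT t
    exact h1.comp (measurable_id.prodMk ih)

/-! ### Concentration of the estimates -/

lemma hasSubgaussianMGF_mono {Ω : Type*} [MeasurableSpace Ω] {μ : Measure Ω} {X : Ω → ℝ}
    {c c' : NNReal} (h : HasSubgaussianMGF X c μ) (hc : c ≤ c') : HasSubgaussianMGF X c' μ :=
  ⟨h.1, fun t => (h.2 t).trans (Real.exp_le_exp.2 (by gcongr))⟩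

section Concentration

variable {d M T : ℕ} {R : DesignRule d} {D : Finset (Vec d)}
variable {Ω : Type*} [MeasurableSpace Ω] {μ : Measure Ω} {η : Ω → ℕ → Fin M → Vec d → ℝ}

lemma measurable_noise_map (hmeas : ∀ t i x, Measurable fun ω => η ω t i x) : Measurable η :=
  measurable_pi_lambda _ fun t => measurable_pi_lambda _ fun i =>
    measurable_pi_lambda _ fun x => hmeas t i x

/-- Events which depend on the noise in disjoint time intervals are independent. -/
lemma measure_past_inter_future (hmeas : ∀ t i x, Measurable fun ω => η ω t i x)
    (hind : iIndepFun (fun (p : ℕ × Fin M) (ω : Ω) => η ω p.1 p.2) μ) (τ τ' : ℕ)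
    {B₁ B₂ : Set (ℕ → Fin M → Vec d → ℝ)} (hB₁ : MeasurableSet B₁) (hB₂ : MeasurableSet B₂)
    (h₁ : ∀ N N', (∀ t < τ, N t = N' t) → (N ∈ B₁ ↔ N' ∈ B₁))
    (h₂ : ∀ N N', (∀ t, τ ≤ t → t < τ' → N t = N' t) → (N ∈ B₂ ↔ N' ∈ B₂)) :
    μ (η ⁻¹' B₁ ∩ η ⁻¹' B₂) = μ (η ⁻¹' B₁) * μ (η ⁻¹' B₂) := by
  classical
  -- Noise on a finite index set is padded with zeros; the events do not see the padding, so
  -- independence of finite subfamilies applies.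
  let ext : (S : Finset (ℕ × Fin M)) → (S → Vec d → ℝ) → (ℕ → Fin M → Vec d → ℝ) :=
    fun S f t i => if h : (t, i) ∈ S then f ⟨(t, i), h⟩ else 0
  have hext : ∀ S, Measurable (ext S) := by
    intro S
    refine measurable_pi_lambda _ fun t => measurable_pi_lambda _ fun i => ?_
    by_cases h : (t, i) ∈ S
    · simp only [ext, dif_pos h]
      exact measurable_pi_apply _
    · simp only [ext, dif_neg h]
      exact measurable_const
  let S₁ : Finset (ℕ × Fin M) := Finset.range τ ×ˢ Finset.univ
  let S₂ : Finset (ℕ × Fin M) := Finset.Ico τ τ' ×ˢ Finset.univ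
  have hdisj : Disjoint S₁ S₂ := by
    rw [Finset.disjoint_left]
    rintro ⟨t, i⟩ h1 h2
    simp only [S₁, S₂, Finset.mem_product, Finset.mem_range, Finset.mem_Ico] at h1 h2
    lia
  have hI := hind.indepFun_finset S₁ S₂ hdisj fun p =>
    measurable_pi_lambda _ fun x => hmeas p.1 p.2 x
  have h := hI.measure_inter_preimage_eq_mul (ext S₁ ⁻¹' B₁) (ext S₂ ⁻¹' B₂)
    (hext S₁ hB₁) (hext S₂ hB₂)
  have e₁ : (fun a (i : S₁) => η a (i : ℕ × Fin M).1 (i : ℕ × Fin M).2) ⁻¹' (ext S₁ ⁻¹' B₁) =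
      η ⁻¹' B₁ := by
    ext ω
    refine h₁ _ _ fun t ht => funext fun i => ?_
    have : (t, i) ∈ S₁ := by simp [S₁, ht]
    simp only [ext, dif_pos this]
  have e₂ : (fun a (i : S₂) => η a (i : ℕ × Fin M).1 (i : ℕ × Fin M).2) ⁻¹' (ext S₂ ⁻¹' B₂) =
      η ⁻¹' B₂ := by
    ext ω
    refine h₂ _ _ fun t ht ht' => funext fun i => ?_
    have : (t, i) ∈ S₂ := by simp [S₂, ht, ht']
    simp only [ext, dif_pos this]
  rwa [e₁, e₂] at h

variable [IsProbabilityMeasure μ]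

namespace Cur

variable (q : Cur D)

lemma arm_mem (hR : R.Valid M T) {j k c : ℕ} (h : q.pull M T R j k = some c) :
    (q.design R).arm c ∈ D :=
  q.sub ((hR.isDesign q).arm_mem c (q.pull_lt h))

/-- For a fixed state `q` the pulled arms are deterministic, so this is Hoeffding's lemma for a sum
of independent bounded variables with fixed coefficients. -/
lemma hasSubgaussianMGF_noiseSum (hR : R.Valid M T) (hM : 1 ≤ M)
    (hmeas : ∀ t i x, Measurable fun ω => η ω t i x)
    (hind : iIndepFun (fun (p : ℕ × Fin M) (ω : Ω) => η ω p.1 p.2) μ)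
    (hbd : ∀ ω t i, ∀ x ∈ D, η ω t i x ∈ Set.Icc (-1 : ℝ) 1)
    (hmean : ∀ t i, ∀ x ∈ D, ∫ ω, η ω t i x ∂μ = 0) (τ : ℕ) (u : Vec d) {V : NNReal}
    (hV : ∑ c ∈ Finset.range (q.design R).size,
      (q.num M T R c : ℝ) * inner ℝ ((q.design R).arm c) u ^ 2 ≤ V) :
    HasSubgaussianMGF (fun ω => q.noiseSum T R u (η ω) τ) V μ := by
  let g : Fin M × ℕ → ℕ × Fin M := fun p => (τ + (M - 1) + p.2, p.1)
  have hg : Function.Injective g := by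
    rintro ⟨i, k⟩ ⟨i', k'⟩ h
    simp only [g, Prod.mk.injEq] at h
    exact Prod.ext h.2 (by simp only; lia)
  let G : Fin M × ℕ → (Vec d → ℝ) → ℝ := fun p f => (q.pull M T R p.1 p.2).elim 0
    fun c => inner ℝ ((q.design R).arm c) u * f ((q.design R).arm c)
  have hG : ∀ p, Measurable (G p) := by
    intro p
    simp only [G]
    cases q.pull M T R p.1 p.2 with
    | none => exact measurable_const
    | some c => exact (measurable_pi_apply _).const_mul _
  have hiind := (hind.precomp hg).comp G hG
  let v : Fin M × ℕ → NNReal := fun p => (q.pull M T R p.1 p.2).elim 0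
    fun c => ⟨inner ℝ ((q.design R).arm c) u ^ 2, sq_nonneg _⟩ * (‖(1 : ℝ) - -1‖₊ / 2) ^ 2
  have hsub : ∀ p ∈ (Finset.univ : Finset (Fin M)) ×ˢ Finset.range (q.pullLen M T R),
      HasSubgaussianMGF (G p ∘ fun ω => η ω (g p).1 (g p).2) (v p) μ := by
    intro p _
    simp only [G, v, Function.comp_def]
    rcases hp : q.pull M T R p.1 p.2 with _ | c
    · exact HasSubgaussianMGF.fun_zero
    · have hc := q.arm_mem hR hp
      exact (hasSubgaussianMGF_of_mem_Icc_of_integral_eq_zero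
        (hmeas _ _ _).aemeasurable (ae_of_all _ fun ω => hbd ω _ _ _ hc)
        (hmean _ _ _ hc)).const_mul _
  have hsum := HasSubgaussianMGF.sum_of_iIndepFun hiind hsub
  have hfun : (fun ω => ∑ p ∈ (Finset.univ : Finset (Fin M)) ×ˢ Finset.range (q.pullLen M T R),
      (G p ∘ fun ω => η ω (g p).1 (g p).2) ω) = fun ω => q.noiseSum T R u (η ω) τ := by
    funext ω
    rw [Finset.sum_product]
    rfl
  rw [hfun] at hsum
  refine hasSubgaussianMGF_mono hsum ?_
  rw [← NNReal.coe_le_coe]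
  refine le_trans (le_of_eq ?_) hV
  have hv : ∀ p, (v p : ℝ) = (q.pull M T R p.1 p.2).elim 0
      fun c => inner ℝ ((q.design R).arm c) u ^ 2 := by
    intro p
    simp only [v]
    cases q.pull M T R p.1 p.2 with
    | none => rfl
    | some c =>
      -- Hoeffding's proxy for values in [-1, 1] is 1, so each pull contributes the square of its
      -- coefficient.
      have h1 : (‖(1 : ℝ) - -1‖₊ / 2) ^ 2 = (1 : NNReal) := by
        rw [← NNReal.coe_inj]
        norm_num
      simp only [Option.elim_some]
      rw [h1]
      exact mul_one _
  rw [NNReal.coe_sum, Finset.sum_product]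
  simp only [hv]
  rw [sum_pull q hM]
  simp only [nsmul_eq_mul]

lemma measureReal_noiseSum_le {V ε : ℝ} {u : Vec d} {τ : ℕ} (hε : 0 ≤ ε) (hV : 0 ≤ V)
    (h : HasSubgaussianMGF (fun ω => q.noiseSum T R u (η ω) τ) ⟨V, hV⟩ μ) :
    μ.real {ω | ε ≤ |q.noiseSum T R u (η ω) τ|} ≤ 2 * Real.exp (-ε ^ 2 / (2 * V)) := by
  have h1 : _ ≤ Real.exp (-ε ^ 2 / (2 * V)) := h.measure_ge_le hε
  have h2 : _ ≤ Real.exp (-ε ^ 2 / (2 * V)) := h.neg.measure_ge_le hε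
  have hsub : {ω | ε ≤ |q.noiseSum T R u (η ω) τ|} ⊆
      {ω | ε ≤ q.noiseSum T R u (η ω) τ} ∪
        {ω | ε ≤ (-fun ω => q.noiseSum T R u (η ω) τ) ω} := by
    intro ω hω
    simp only [Set.mem_union, Set.mem_ofPred_eq, Pi.neg_apply] at hω ⊢
    exact le_abs.1 hω
  calc μ.real {ω | ε ≤ |q.noiseSum T R u (η ω) τ|}
      ≤ _ := measureReal_mono hsub
    _ ≤ _ := measureReal_union_le _ _
    _ ≤ 2 * Real.exp (-ε ^ 2 / (2 * V)) := by
        linarith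

/-- The estimate of a phase which starts at time `τ` is accurate on the active set. -/
def Accurate (T : ℕ) (R : DesignRule d) (θ : Vec d) (N : ℕ → Fin M → Vec d → ℝ) (τ : ℕ) : Prop :=
  ∀ x ∈ q.active, |inner ℝ (q.fit T R θ N τ - θ) x| ≤ (1 / 2) ^ q.phase

/-- A cover of the event of an inaccurate estimate, which depends on the noise in the pulling
stage of the phase only. -/
lemma exists_inaccurate_cover (hR : R.Valid M T) (hd : 0 < d) (hMT : 1 < M * T)
    (hmeas : ∀ t i x, Measurable fun ω => η ω t i x)
    (hind : iIndepFun (fun (p : ℕ × Fin M) (ω : Ω) => η ω p.1 p.2) μ)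
    (hbd : ∀ ω t i, ∀ x ∈ D, η ω t i x ∈ Set.Icc (-1 : ℝ) 1)
    (hmean : ∀ t i, ∀ x ∈ D, ∫ ω, η ω t i x ∂μ = 0) (θ : Vec d) (τ : ℕ) :
    ∃ B : Set (ℕ → Fin M → Vec d → ℝ), MeasurableSet B ∧
      (∀ N N', (∀ t, τ ≤ t → t < τ + q.len M T R → N t = N' t) → (N ∈ B ↔ N' ∈ B)) ∧
      (∀ N, ¬ q.Accurate T R θ N τ → N ∈ B) ∧
      μ.real (η ⁻¹' B) ≤ 4 * d * ((M * T : ℝ) ^ 75)⁻¹ := by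
  have hM : 1 ≤ M := by by_contra h; simp [show M = 0 by lia] at hMT
  obtain ⟨f, hfA, hf⟩ := exists_norming hd q.active q.ne
  choose u hu using fun j => q.exists_moment_num_eq hR hd hMT (hfA j)
  set ε : ℝ := (1 / 2) ^ q.phase / √(2 * d) with hε
  have hε0 : 0 ≤ ε := by positivity
  have hκ := budget_pos hd hMT q.phase
  have hd0 : (0 : ℝ) < d := by exact_mod_cast hd
  -- Large error at one of the 2d norming points; the union bound has 2d terms however many arms are
  -- active.
  refine ⟨⋃ j, {N | ε ≤ |q.noiseSum T R (u j) N τ|}, ?_, ?_, ?_, ?_⟩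
  · refine MeasurableSet.iUnion fun j => measurableSet_le measurable_const ?_
    refine Measurable.abs ?_
    unfold noiseSum
    refine Finset.measurable_sum _ fun i _ => Finset.measurable_sum _ fun k _ => ?_
    cases q.pull M T R i k with
    | none => exact measurable_const
    | some c => exact (measurable_noise _ _ _).const_mul _
  · intro N N' h
    have : ∀ j, q.noiseSum T R (u j) N τ = q.noiseSum T R (u j) N' τ := by
      intro j
      refine Finset.sum_congr rfl fun i _ => Finset.sum_congr rfl fun k hk => ?_
      have hk' := Finset.mem_range.1 hk
      rw [h (τ + (M - 1) + k) (by lia) (by unfold len; lia)]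
    simp only [Set.mem_iUnion, Set.mem_ofPred_eq, this]
  · intro N hN
    by_contra hB
    simp only [Set.mem_iUnion, Set.mem_ofPred_eq, not_exists, not_le] at hB
    refine hN fun x hx => hf _ _ (by positivity) (fun j => ?_) x hx
    rw [q.inner_fit_sub θ N τ hR hd hMT (hu j)]
    exact (hB j).le
  · have hV0 : 0 ≤ 2 * d / budget d M T q.phase := by positivity
    have hj : ∀ j, μ.real {ω | ε ≤ |q.noiseSum T R (u j) (η ω) τ|} ≤
        2 * ((M * T : ℝ) ^ 75)⁻¹ := by
      intro j
      have hlev := (hR.isDesign q).leverage_le hκ (m := fun c => (q.num M T R c : ℝ))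
        (fun c _ => le_trans (le_of_eq (by unfold budget; ring)) (Nat.le_ceil _)) (hfA j) (hu j)
      have hsg := q.hasSubgaussianMGF_noiseSum hR hM hmeas hind hbd hmean τ (u j)
        (V := ⟨2 * d / budget d M T q.phase, hV0⟩) hlev
      refine (q.measureReal_noiseSum_le hε0 hV0 hsg).trans (le_of_eq ?_)
      have hMT0 : (0 : ℝ) < M * T := by exact_mod_cast (by lia : 0 < M * T)
      -- Here ε² = 4^(-l) / (2d), so the factors 4^l and d² of the budget cancel and 600/8 = 75 is
      -- left.
      have hexp : -ε ^ 2 / (2 * (2 * d / budget d M T q.phase)) = -(75 * Real.log (M * T)) := by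
        have h4 : ((1 / 2 : ℝ) ^ q.phase) ^ 2 * 4 ^ q.phase = 1 := by
          rw [← pow_mul, mul_comm q.phase, pow_mul, ← mul_pow]
          norm_num
        rw [hε, div_pow, Real.sq_sqrt (by positivity)]
        unfold budget
        field_simp
        linear_combination (-600 * Real.log (M * T)) * h4
      rw [hexp, Real.exp_neg]
      congr 2
      have : (75 : ℝ) * Real.log (M * T) = ((75 : ℕ) : ℝ) * Real.log (M * T) := by norm_num
      rw [this, Real.exp_nat_mul, Real.exp_log hMT0]
    calc μ.real (η ⁻¹' ⋃ j, {N | ε ≤ |q.noiseSum T R (u j) N τ|})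
        = μ.real (⋃ j, {ω | ε ≤ |q.noiseSum T R (u j) (η ω) τ|}) := by
          rw [Set.preimage_iUnion]; rfl
      _ ≤ ∑ j, μ.real {ω | ε ≤ |q.noiseSum T R (u j) (η ω) τ|} := measureReal_iUnion_fintype_le _
      _ ≤ ∑ _j : Fin (2 * d), 2 * ((M * T : ℝ) ^ 75)⁻¹ := Finset.sum_le_sum fun j _ => hj j
      _ = 4 * d * ((M * T : ℝ) ^ 75)⁻¹ := by
          simp
          ring

end Cur

/-- Some phase which is completed before time `T` yields an inaccurate estimate. -/
def Failure (T : ℕ) (R : DesignRule d) (hD : D.Nonempty) (θ : Vec d)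
    (N : ℕ → Fin M → Vec d → ℝ) : Prop :=
  ∃ τ < T, (cur T R hD θ N τ).step = 0 ∧ τ + (cur T R hD θ N τ).len M T R ≤ T ∧
    ¬ (cur T R hD θ N τ).Accurate T R θ N τ

/-- The budget, which is at least 4^l d², must fit into the MT slots of the horizon. This bounds the
number of phases and removes d from the failure probability. -/
lemma le_mul_of_len_le (hR : R.Valid M T) (hd : 0 < d) (hT : 3 ≤ M * T) {q : Cur D} {τ : ℕ}
    (hlen : τ + q.len M T R ≤ T) : 4 ^ q.phase ≤ M * T ∧ d ≤ M * T := by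
  have hM : 1 ≤ M := by by_contra h; simp [show M = 0 by lia] at hT
  have hMT3 : (3 : ℝ) ≤ M * T := by exact_mod_cast hT
  have hlog : 1 ≤ Real.log (M * T) := by
    rw [Real.le_log_iff_exp_le (by linarith)]
    linarith [Real.exp_one_lt_d9]
  have h1 := budget_le_mul_pullLen hR hM q
  have h2 : ((q.pullLen M T R : ℕ) : ℝ) ≤ T := by
    exact_mod_cast (by unfold Cur.len at hlen; lia : q.pullLen M T R ≤ T)
  have h3 : budget d M T q.phase ≤ M * T := h1.trans (by gcongr)
  have hd1 : (1 : ℝ) ≤ d := by exact_mod_cast hd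
  have h4 : (1 : ℝ) ≤ 4 ^ q.phase := one_le_pow₀ (by norm_num)
  have h5 : (4 : ℝ) ^ q.phase * d ^ 2 ≤ M * T := by
    refine le_trans ?_ h3
    unfold budget
    have : (0 : ℝ) ≤ 4 ^ q.phase * d ^ 2 := by positivity
    nlinarith
  have h6 : (4 : ℝ) ^ q.phase ≤ M * T :=
    (le_mul_of_one_le_right (by positivity) (one_le_pow₀ hd1)).trans h5
  have h7 : (d : ℝ) ≤ M * T :=
    (le_self_pow₀ hd1 two_ne_zero).trans ((le_mul_of_one_le_left (by positivity) h4).trans h5)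
  exact ⟨by exact_mod_cast h6, by exact_mod_cast h7⟩

/-- For a start time τ, the event that the state is q is independent of the cover for (q, τ), so
their joint probability is at most P(state = q) · ε. Summed over q the first factors give 1; only
the T start times enter the union bound, not the number of states. -/
lemma measure_failure_le (hR : R.Valid M T) (hd : 0 < d) (hT : 3 ≤ M * T)
    (hmeas : ∀ t i x, Measurable fun ω => η ω t i x)
    (hind : iIndepFun (fun (p : ℕ × Fin M) (ω : Ω) => η ω p.1 p.2) μ)
    (hbd : ∀ ω t i, ∀ x ∈ D, η ω t i x ∈ Set.Icc (-1 : ℝ) 1)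
    (hmean : ∀ t i, ∀ x ∈ D, ∫ ω, η ω t i x ∂μ = 0) (hD : D.Nonempty) (θ : Vec d) :
    μ.real {ω | Failure T R hD θ (η ω)} ≤ 4 / (M * T) := by
  have hMT : 1 < M * T := by lia
  have hM : 1 ≤ M := by by_contra h; simp [show M = 0 by lia] at hT
  have hMT3 : (3 : ℝ) ≤ M * T := by exact_mod_cast hT
  choose B hBm hBf hBacc hBμ using fun (q : Cur D) (τ : ℕ) =>
    q.exists_inaccurate_cover hR hd hMT hmeas hind hbd hmean θ τ
  set ε : ENNReal := ENNReal.ofReal (4 * (M * T) * ((M * T : ℝ) ^ 75)⁻¹) with hε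
  let Q : ℕ → Set (Cur D) := fun τ => {q | τ + q.len M T R ≤ T}
  let F : ℕ → Cur D → Set Ω := fun τ q =>
    {ω | cur T R hD θ (η ω) τ = q} ∩ {ω | q ∈ Q τ ∧ η ω ∈ B q τ}
  have hηm := measurable_noise_map hmeas
  have hcurm : ∀ τ, Measurable fun ω => cur T R hD θ (η ω) τ := fun τ =>
    (measurable_cur hD θ hR hd hMT τ).comp hηm
  have hF : ∀ τ q, μ (F τ q) ≤ μ {ω | cur T R hD θ (η ω) τ = q} * ε := by
    intro τ q
    by_cases hq : q ∈ Q τ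
    · have hdMT : (d : ℝ) ≤ M * T := by exact_mod_cast (le_mul_of_len_le hR hd hT hq).2
      have h := measure_past_inter_future (μ := μ) hmeas hind τ (τ + q.len M T R)
        (B₁ := {N | cur T R hD θ N τ = q}) (B₂ := B q τ)
        (measurable_cur hD θ hR hd hMT τ (measurableSet_singleton q)) (hBm q τ)
        (fun N N' hN => by
          simp only [Set.mem_ofPred_eq]
          rw [cur_congr hD (len_pos hR hd hMT) hN])
        (hBf q τ)
      have hFq : F τ q = η ⁻¹' {N | cur T R hD θ N τ = q} ∩ η ⁻¹' B q τ := by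
        ext ω
        simp only [F, Set.mem_inter_iff, Set.mem_ofPred_eq, hq, true_and, Set.mem_preimage]
      rw [hFq, h]
      refine mul_le_mul_right ?_ _
      rw [hε, ← ENNReal.ofReal_toReal (measure_ne_top μ (η ⁻¹' B q τ))]
      refine ENNReal.ofReal_le_ofReal ((hBμ q τ).trans ?_)
      gcongr
    · have : F τ q = ∅ := by
        ext ω
        simp [F, hq]
      rw [this, measure_empty]
      exact zero_le
  have hsum : ∀ τ, ∑' q, μ {ω | cur T R hD θ (η ω) τ = q} = 1 := by
    intro τ
    rw [← measure_iUnion]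
    · have : (⋃ q, {ω | cur T R hD θ (η ω) τ = q}) = Set.univ := by
        ext ω; simp
      rw [this, measure_univ]
    · intro q q' hne
      refine Set.disjoint_left.2 fun ω h h' => hne ?_
      exact (Eq.symm h).trans h'
    · exact fun q => hcurm τ (measurableSet_singleton q)
  have hmain : μ {ω | Failure T R hD θ (η ω)} ≤ T * ε := by
    calc μ {ω | Failure T R hD θ (η ω)} ≤ μ (⋃ τ ∈ Finset.range T, ⋃ q, F τ q) := by
          refine measure_mono ?_
          rintro ω ⟨τ, hτ, -, hlen, hacc⟩
          simp only [Set.mem_iUnion]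
          exact ⟨τ, Finset.mem_range.2 hτ, _, rfl, hlen, hBacc _ _ _ hacc⟩
      _ ≤ ∑ τ ∈ Finset.range T, μ (⋃ q, F τ q) := measure_biUnion_finset_le _ _
      _ ≤ ∑ τ ∈ Finset.range T, ε := by
          refine Finset.sum_le_sum fun τ _ => ?_
          calc μ (⋃ q, F τ q) ≤ ∑' q, μ (F τ q) := measure_iUnion_le _
            _ ≤ ∑' q, μ {ω | cur T R hD θ (η ω) τ = q} * ε := ENNReal.tsum_le_tsum (hF τ)
            _ = ε := by rw [ENNReal.tsum_mul_right, hsum, one_mul]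
      _ = T * ε := by simp
  have h1 : μ.real {ω | Failure T R hD θ (η ω)} ≤ T * (4 * (M * T) * ((M * T : ℝ) ^ 75)⁻¹) := by
    refine ENNReal.toReal_le_of_le_ofReal (by positivity) (hmain.trans (le_of_eq ?_))
    rw [hε, ENNReal.ofReal_mul (Nat.cast_nonneg T), ENNReal.ofReal_natCast]
  refine h1.trans ?_
  have hTMT : (T : ℝ) ≤ M * T := by
    exact_mod_cast Nat.le_mul_of_pos_left T hM
  set X : ℝ := M * T with hX
  have hX1 : (1 : ℝ) ≤ X ^ 72 := one_le_pow₀ (by linarith)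
  have hX0 : 0 < X := by linarith
  -- Only the power X⁻¹ is needed, to offset the trivial regret bound 2MT; the rest is discarded.
  calc (T : ℝ) * (4 * X * (X ^ 75)⁻¹) ≤ X * (4 * X * (X ^ 75)⁻¹) := by gcongr
    _ = 4 / X * (X ^ 72)⁻¹ := by field_simp
    _ ≤ 4 / X * 1 := by gcongr; exact inv_le_one_of_one_le₀ hX1
    _ = 4 / X := mul_one _

end Concentration

/-! ### Accounting over the phases -/

section Accounting

variable {d M T : ℕ} {R : DesignRule d} {D : Finset (Vec d)} (hD : D.Nonempty)
  {θ : Vec d} {N : ℕ → Fin M → Vec d → ℝ}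

lemma cur_succ_of_le (t : ℕ) (h : ¬ (cur T R hD θ N t).step + 1 < (cur T R hD θ N t).len M T R) :
    (cur T R hD θ N (t + 1)).phase = (cur T R hD θ N t).phase + 1 ∧
    (cur T R hD θ N (t + 1)).step = 0 ∧
    (cur T R hD θ N (t + 1)).active = eliminate (cur T R hD θ N t).phase
      (cur T R hD θ N t).active
      ((cur T R hD θ N t).fit T R θ N (t - (cur T R hD θ N t).step)) := by
  have : cur T R hD θ N (t + 1) = (cur T R hD θ N t).next T R θ N t := rfl
  unfold Cur.next at this
  rw [if_neg h] at this
  rw [this]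
  exact ⟨rfl, rfl, rfl⟩

/-- A completed phase l satisfies 4^l ≤ MT; the summand 1 accounts for the phase in progress. -/
lemma phase_le (hR : R.Valid M T) (hd : 0 < d) (hT : 3 ≤ M * T) {t : ℕ} (ht : t ≤ T) :
    (cur T R hD θ N t).phase ≤ Nat.log 4 (M * T) + 1 := by
  induction t with
  | zero => exact Nat.succ_le_succ (Nat.zero_le _)
  | succ t ih =>
    have hlen := len_pos (D := D) hR hd (show 1 < M * T by lia)
    obtain ⟨hst, hsl⟩ := cur_step (N := N) (θ := θ) hD hlen t
    by_cases h : (cur T R hD θ N t).step + 1 < (cur T R hD θ N t).len M T R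
    · rw [cur_succ_of_lt hD h]
      exact ih (by lia)
    · rw [(cur_succ_of_le hD t h).1]
      have h4 := (le_mul_of_len_le (q := cur T R hD θ N t) hR hd hT
        (τ := t - (cur T R hD θ N t).step) (by lia)).1
      exact Nat.succ_le_succ (Nat.le_log_of_pow_le (by norm_num) h4)

/-- Amortization of a quantity which is accumulated in every time step, over the phases. -/
lemma sum_cur_le (hlen : ∀ q : Cur D, 0 < q.len M T R) (f : Cur D → ℝ) (hf : ∀ q, 0 ≤ f q)
    (bd : ℕ → ℝ) (hbd : ∀ q : Cur D,
      ∑ s ∈ Finset.range (q.len M T R), f { q with step := s } ≤ bd q.phase) (t : ℕ) :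
    ∑ t' ∈ Finset.range t, f (cur T R hD θ N t') ≤
      ∑ l ∈ Finset.range ((cur T R hD θ N t).phase + 1), max (bd l) 0 := by
  -- Completed phases are charged in full, the current one only for the steps already made; this
  -- form is stable under induction.
  have key : ∑ t' ∈ Finset.range t, f (cur T R hD θ N t') ≤
      ∑ l ∈ Finset.range (cur T R hD θ N t).phase, max (bd l) 0 +
        ∑ s ∈ Finset.range (cur T R hD θ N t).step, f { cur T R hD θ N t with step := s } := by
    induction t with
    | zero =>
      rw [Finset.range_zero, Finset.sum_empty]
      exact add_nonneg (Finset.sum_nonneg fun _ _ => le_max_right _ _)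
        (Finset.sum_nonneg fun _ _ => hf _)
    | succ t ih =>
      obtain ⟨hst, hsl⟩ := cur_step (N := N) (θ := θ) hD hlen t
      rw [Finset.sum_range_succ]
      have hs := Finset.sum_range_succ
        (fun s => f { cur T R hD θ N t with step := s }) (cur T R hD θ N t).step
      by_cases h : (cur T R hD θ N t).step + 1 < (cur T R hD θ N t).len M T R
      · rw [cur_succ_of_lt hD h]
        simp only
        rw [hs]
        linarith
      · obtain ⟨h1, h2, -⟩ := cur_succ_of_le hD t h
        rw [h1, h2, Finset.range_zero, Finset.sum_empty, Finset.sum_range_succ]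
        have h3 := hbd (cur T R hD θ N t)
        rw [show (cur T R hD θ N t).len M T R = (cur T R hD θ N t).step + 1 by lia, hs] at h3
        have h4 := le_max_left (bd (cur T R hD θ N t).phase) 0
        linarith
  refine key.trans ?_
  rw [Finset.sum_range_succ]
  gcongr
  refine le_trans ?_ ((hbd _).trans (le_max_left _ _))
  obtain ⟨-, hsl⟩ := cur_step (N := N) (θ := θ) hD hlen t
  exact Finset.sum_le_sum_of_subset_of_nonneg
    (Finset.range_subset_range.2 hsl.le) fun _ _ _ => hf _

lemma sum_ite_le_of_unique {ι : Type*} (s : Finset ι) (P : ι → Prop) [DecidablePred P] (a : ℕ)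
    (hP : ∀ x y, P x → P y → x = y) : ∑ x ∈ s, (if P x then a else 0) ≤ a := by
  rw [← Finset.sum_filter, Finset.sum_const, smul_eq_mul]
  have : (s.filter P).card ≤ 1 := Finset.card_le_one.2 fun x hx y hy =>
    hP x y (Finset.mem_filter.1 hx).2 (Finset.mem_filter.1 hy).2
  nlinarith

/-- Communication cost of a phase. -/
lemma sum_cost_le (q : Cur D) :
    ∑ s ∈ Finset.range (q.len M T R), ({ q with step := s } : Cur D).cost M T R ≤
      3 * ((q.design R).size + M) + M * d := by
  set n := q.len M T R
  set p := q.pullLen M T R with hp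
  let a : Fin M → ℕ := fun j => (q.work M T R j).length
  have ha : ∑ j, a j ≤ (q.design R).size + M := by
    have := sum_length_assignment_le M (q.design R).size (q.num M T R)
    rwa [Finset.sum_range] at this
  -- The three kinds of messages: assignment, report, estimate. For each kind, the agent other than
  -- 0 determines the time step, so every such agent is charged once per phase.
  let P₁ : ℕ → Fin M → Fin M → Prop := fun s i j =>
    (i : ℕ) = 0 ∧ s < M - 1 ∧ (j : ℕ) = s + 1
  let P₂ : ℕ → Fin M → Fin M → Prop := fun s i j =>
    (j : ℕ) = 0 ∧ 0 < (i : ℕ) ∧ s + 1 = (M - 1) + p + i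
  let P₃ : ℕ → Fin M → Fin M → Prop := fun s i j =>
    (i : ℕ) = 0 ∧ 0 < (j : ℕ) ∧ s + 1 = 2 * (M - 1) + p + j
  have hcost : ∀ s, ({ q with step := s } : Cur D).cost M T R ≤
      ∑ i : Fin M, ∑ j : Fin M, ((if P₁ s i j then 2 * a j else 0) +
        (if P₂ s i j then a i else 0) + (if P₃ s i j then d else 0)) := by
    intro s
    refine Finset.sum_le_sum fun i _ => Finset.sum_le_sum fun j _ => ?_
    change (if P₁ s i j then 2 * a j else if P₂ s i j then a i else
      if P₃ s i j then d else 0) ≤ _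
    split_ifs <;> lia
  refine (Finset.sum_le_sum fun s _ => hcost s).trans ?_
  simp only [Finset.sum_add_distrib]
  have swap : ∀ F : ℕ → Fin M → Fin M → ℕ, ∑ s ∈ Finset.range n, ∑ i, ∑ j, F s i j =
      ∑ j, ∑ x ∈ Finset.range n ×ˢ (Finset.univ : Finset (Fin M)), F x.1 x.2 j := by
    intro F
    rw [← Finset.sum_product' _ _ fun s i => ∑ j, F s i j, Finset.sum_comm]
  have swap' : ∀ F : ℕ → Fin M → Fin M → ℕ, ∑ s ∈ Finset.range n, ∑ i, ∑ j, F s i j =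
      ∑ i, ∑ x ∈ Finset.range n ×ˢ (Finset.univ : Finset (Fin M)), F x.1 i x.2 := by
    intro F
    rw [Finset.sum_comm]
    exact Finset.sum_congr rfl fun i _ => by rw [Finset.sum_product]
  have h₁ : ∑ s ∈ Finset.range n, ∑ i : Fin M, ∑ j : Fin M, (if P₁ s i j then 2 * a j else 0) ≤
      ∑ j, 2 * a j := by
    rw [swap]
    refine Finset.sum_le_sum fun j _ => sum_ite_le_of_unique _ (fun x : ℕ × Fin M => P₁ x.1 x.2 j) _ ?_
    rintro ⟨s, i⟩ ⟨s', i'⟩ ⟨h1, -, h2⟩ ⟨h1', -, h2'⟩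
    exact Prod.ext (by lia) (Fin.ext (by lia))
  have h₂ : ∑ s ∈ Finset.range n, ∑ i : Fin M, ∑ j : Fin M, (if P₂ s i j then a i else 0) ≤
      ∑ i, a i := by
    rw [swap']
    refine Finset.sum_le_sum fun i _ => sum_ite_le_of_unique _ (fun x : ℕ × Fin M => P₂ x.1 i x.2) _ ?_
    rintro ⟨s, j⟩ ⟨s', j'⟩ ⟨h1, -, h2⟩ ⟨h1', -, h2'⟩
    exact Prod.ext (by lia) (Fin.ext (by lia))
  have h₃ : ∑ s ∈ Finset.range n, ∑ i : Fin M, ∑ j : Fin M, (if P₃ s i j then d else 0) ≤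
      ∑ _j : Fin M, d := by
    rw [swap]
    refine Finset.sum_le_sum fun j _ => sum_ite_le_of_unique _ (fun x : ℕ × Fin M => P₃ x.1 x.2 j) _ ?_
    rintro ⟨s, i⟩ ⟨s', i'⟩ ⟨h1, -, h2⟩ ⟨h1', -, h2'⟩
    exact Prod.ext (by lia) (Fin.ext (by lia))
  rw [← Finset.mul_sum] at h₁
  simp only [Finset.sum_const, Finset.card_univ, Fintype.card_fin, smul_eq_mul] at h₃
  lia

/-! ### Regret -/

/-- Sum over a phase of a function of the assigned pulls. -/
lemma sum_target (hM : 1 ≤ M) (q : Cur D) (a b : ℝ) :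
    ∑ s ∈ Finset.range (q.len M T R), ∑ i : Fin M,
      (({ q with step := s } : Cur D).target M T R i).elim b (fun _ => a) =
      b * (M * q.len M T R) +
        (a - b) * (∑ c ∈ Finset.range (q.design R).size, q.num M T R c : ℕ) := by
  -- Charge b to all M · `len` slots and correct by a - b on the assigned ones, which `sum_pull`
  -- counts.
  have helim : ∀ o : Option ℕ, o.elim b (fun _ => a) = b + o.elim 0 (fun _ => a - b) := by
    intro o; cases o <;> simp
  have h0 : ∀ i : Fin M, ∑ s ∈ Finset.range (q.len M T R),
      (({ q with step := s } : Cur D).target M T R i).elim 0 (fun _ => a - b) =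
      ∑ k ∈ Finset.range (q.pullLen M T R), (q.pull M T R i k).elim 0 (fun _ => a - b) := by
    intro i
    have hlen : q.len M T R = (M - 1) + q.pullLen M T R + 2 * (M - 1) := by
      unfold Cur.len; lia
    have ht : ∀ s, ({ q with step := s } : Cur D).target M T R i =
        if M - 1 ≤ s ∧ s < (M - 1) + q.pullLen M T R then q.pull M T R i (s - (M - 1))
        else none := fun s => rfl
    simp only [ht]
    rw [hlen, Finset.sum_range_add, Finset.sum_range_add, Finset.sum_eq_zero, zero_add]
    · rw [add_eq_left.2 (Finset.sum_eq_zero _)]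
      · refine Finset.sum_congr rfl fun k hk => ?_
        have := Finset.mem_range.1 hk
        rw [if_pos (by lia), Nat.add_sub_cancel_left]
      · intro k _
        rw [if_neg (by lia)]; rfl
    · intro k hk
      have := Finset.mem_range.1 hk
      rw [if_neg (by lia)]; rfl
  simp only [helim, Finset.sum_add_distrib]
  have h1 : ∑ s ∈ Finset.range (q.len M T R), ∑ i : Fin M,
      (({ q with step := s } : Cur D).target M T R i).elim 0 (fun _ => a - b) =
      (a - b) * (∑ c ∈ Finset.range (q.design R).size, q.num M T R c : ℕ) := by
    rw [Finset.sum_comm, Finset.sum_congr rfl fun i _ => h0 i, q.sum_pull hM, Nat.cast_sum,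
      Finset.mul_sum]
    exact Finset.sum_congr rfl fun c _ => by rw [nsmul_eq_mul, mul_comm]
  rw [h1]
  simp
  ring

/-- The suboptimality of an arm. -/
noncomputable def gap (hD : D.Nonempty) (θ x : Vec d) : ℝ :=
  D.sup' hD (fun x => inner ℝ x θ) - inner ℝ x θ

lemma abs_inner_le_one {x θ : Vec d} (hx : ‖x‖ ≤ 1) (hθ : ‖θ‖ ≤ 1) : |inner ℝ x θ| ≤ 1 :=
  (abs_real_inner_le_norm x θ).trans (mul_le_one₀ hx (norm_nonneg _) hθ)

lemma gap_nonneg {x : Vec d} (hx : x ∈ D) : 0 ≤ gap hD θ x :=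
  sub_nonneg.2 (Finset.le_sup' (fun x => inner ℝ x θ) hx)

lemma gap_le_two (hD1 : ∀ x ∈ D, ‖x‖ ≤ 1) (hθ : ‖θ‖ ≤ 1) {x : Vec d} (hx : x ∈ D) :
    gap hD θ x ≤ 2 := by
  have h1 : D.sup' hD (fun x => inner ℝ x θ) ≤ 1 :=
    Finset.sup'_le hD _ fun y hy => (abs_le.1 (abs_inner_le_one (hD1 y hy) hθ)).2
  have h2 := (abs_le.1 (abs_inner_le_one (hD1 x hx) hθ)).1
  unfold gap
  linarith

/-- Unless there is a failure, the optimal arm stays active, and the gaps of the active arms shrink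
geometrically. -/
lemma gap_le_of_not_failure (hR : R.Valid M T) (hd : 0 < d) (hMT : 1 < M * T)
    (hD1 : ∀ x ∈ D, ‖x‖ ≤ 1) (hθ : ‖θ‖ ≤ 1) (hN : ¬ Failure T R hD θ N) {t : ℕ} (ht : t ≤ T) :
    (∃ x ∈ (cur T R hD θ N t).active, gap hD θ x = 0) ∧
      ∀ x ∈ (cur T R hD θ N t).active, gap hD θ x ≤ 8 * (1 / 2) ^ (cur T R hD θ N t).phase := by
  induction t with
  | zero =>
    constructor
    · obtain ⟨x, hx, h⟩ := Finset.exists_mem_eq_sup' hD (fun x => inner ℝ x θ)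
      exact ⟨x, hx, by rw [gap, h, sub_self]⟩
    · intro x hx
      refine (gap_le_two hD hD1 hθ hx).trans ?_
      norm_num [cur]
  | succ t ih =>
    obtain ⟨⟨b, hb, hb0⟩, hgap⟩ := ih (by lia)
    obtain ⟨hst, hsl⟩ := cur_step (N := N) (θ := θ) hD (len_pos hR hd hMT) t
    by_cases h : (cur T R hD θ N t).step + 1 < (cur T R hD θ N t).len M T R
    · rw [cur_succ_of_lt hD h]
      exact ⟨⟨b, hb, hb0⟩, hgap⟩
    · obtain ⟨h1, -, h3⟩ := cur_succ_of_le hD t h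
      rw [h1, h3]
      have hcur := cur_sub_step (T := T) (R := R) (θ := θ) (N := N) hD t
      set q := cur T R hD θ N t with hq
      set v := q.fit T R θ N (t - q.step) with hv
      have hacc : ∀ x ∈ q.active, |inner ℝ (v - θ) x| ≤ (1 / 2) ^ q.phase := by
        by_contra hna
        refine hN ⟨t - q.step, by lia, ?_⟩
        rw [hcur]
        refine ⟨rfl, ?_, hna⟩
        change t - q.step + q.len M T R ≤ T
        lia
      have herr : ∀ x ∈ q.active, ∀ y ∈ q.active,
          -- Each of the two arms contributes an error of at most 2^(-l).
          |inner ℝ v (x - y) - (gap hD θ y - gap hD θ x)| ≤ 2 * (1 / 2) ^ q.phase := by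
        intro x hx y hy
        have e1 := abs_le.1 (hacc x hx)
        have e2 := abs_le.1 (hacc y hy)
        rw [inner_sub_left, real_inner_comm x θ] at e1
        rw [inner_sub_left, real_inner_comm y θ] at e2
        rw [inner_sub_right, abs_le]
        unfold gap
        constructor <;> linarith [e1.1, e1.2, e2.1, e2.2]
      refine ⟨⟨b, ?_, hb0⟩, ?_⟩
      -- An optimal arm has gap 0, so its estimated deficit is error alone, which is within the
      -- elimination threshold.
      · refine Finset.mem_filter.2 ⟨hb, fun x hx => ?_⟩
        have e1 := (abs_le.1 (herr x hx b hb)).2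
        have e2 := gap_nonneg hD (θ := θ) (q.sub hx)
        linarith
      · intro x hx
        obtain ⟨hx, hxe⟩ := Finset.mem_filter.1 hx
        -- Threshold plus error bound the gap of a survivor by 4 · 2^(-l) = 8 · 2^(-(l+1)).
        have e1 := (abs_le.1 (herr b hb x hx)).1
        have e2 := hxe b hb
        rw [pow_succ]
        linarith

/-- Pulls of a design in a phase. -/
lemma sum_num_le (hR : R.Valid M T) (hd : 3 ≤ d) (hT : 3 ≤ M * T) (q : Cur D) :
    ((∑ c ∈ Finset.range (q.design R).size, q.num M T R c : ℕ) : ℝ) ≤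
      648 * 4 ^ q.phase * (d : ℝ) ^ 2 * Real.log (M * T) := by
  have hMT3 : (3 : ℝ) ≤ M * T := by exact_mod_cast hT
  have hlog : 1 ≤ Real.log (M * T) := by
    rw [Real.le_log_iff_exp_le (by linarith)]
    linarith [Real.exp_one_lt_d9]
  have hd3 : (3 : ℝ) ≤ d := by exact_mod_cast hd
  have h1 := (hR.isDesign q).sum_pulls_le (by linarith)
  have h2 := (hR.isDesign q).size_le
  have h3 : Real.log (Real.log d) ≤ d := by
    have e1 : Real.log d ≤ d - 1 := Real.log_le_sub_one_of_pos (by linarith)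
    have e2 : 0 < Real.log d := Real.log_pos (by linarith)
    have e3 := Real.log_le_sub_one_of_pos e2
    linarith
  have h4 : (1 : ℝ) ≤ 4 ^ q.phase := one_le_pow₀ (by norm_num)
  -- The rounding loss is absorbed into the main term: 648 = 600 + 48.
  have h5 : 48 * d * Real.log (Real.log d) ≤ 48 * (d : ℝ) ^ 2 := by nlinarith
  have h6 : (d : ℝ) ^ 2 ≤ 4 ^ q.phase * d ^ 2 * Real.log (M * T) := by
    have : (d : ℝ) ^ 2 ≤ 4 ^ q.phase * d ^ 2 := le_mul_of_one_le_left (by positivity) h4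
    exact this.trans (le_mul_of_one_le_right (by positivity) hlog)
  refine h1.trans ?_
  unfold budget
  linarith

/-- Upper bound for the regret in a time step, up to `8 M / B`. -/
noncomputable def Cur.loss (M T : ℕ) (R : DesignRule d) (B : ℝ) (q : Cur D) : ℝ :=
  ∑ i : Fin M, (q.target M T R i).elim 2
    fun _ => if (2 : ℝ) ^ q.phase ≤ B then 8 / 2 ^ q.phase else 0

lemma Cur.loss_nonneg (B : ℝ) (q : Cur D) : 0 ≤ q.loss M T R B := by
  refine Finset.sum_nonneg fun i _ => ?_
  cases q.target M T R i with
  | none => norm_num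
  | some c =>
    simp only [Option.elim_some]
    split_ifs <;> positivity

/-- Unassigned slots number at most 3M(M - 1) for communication plus M for rounding up the share per
agent, and cost 2 each. The assigned pulls cost 8 · 2^(-l) each, and 5184 = 8 · 648. -/
lemma sum_loss_le (hR : R.Valid M T) (hd : 3 ≤ d) (hT : 3 ≤ M * T) (B : ℝ) (q : Cur D) :
    ∑ s ∈ Finset.range (q.len M T R), ({ q with step := s } : Cur D).loss M T R B ≤
      6 * (M : ℝ) ^ 2 + if (2 : ℝ) ^ q.phase ≤ B then
        5184 * (d : ℝ) ^ 2 * Real.log (M * T) * 2 ^ q.phase else 0 := by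
  have hM : 1 ≤ M := by by_contra h; simp [show M = 0 by lia] at hT
  have hM1 : (1 : ℝ) ≤ M := by exact_mod_cast hM
  refine (sum_target hM q (if (2 : ℝ) ^ q.phase ≤ B then 8 / 2 ^ q.phase else 0) 2).le.trans ?_
  set n := ∑ c ∈ Finset.range (q.design R).size, q.num M T R c with hn
  have h1 := sum_num_le hR hd hT q
  have h2 : ((M * q.pullLen M T R : ℕ) : ℝ) ≤ ((n + M : ℕ) : ℝ) := by
    exact_mod_cast (mul_perAgent_lt hM (q.design R).size (q.num M T R)).le
  have h3 : (q.len M T R : ℝ) = 3 * (M - 1) + q.pullLen M T R := by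
    unfold Cur.len
    push_cast [hM]
    ring
  push_cast at h2 h1
  rw [h3]
  have h4 : (if (2 : ℝ) ^ q.phase ≤ B then 8 / (2 : ℝ) ^ q.phase else 0) * (n : ℝ) ≤
      if (2 : ℝ) ^ q.phase ≤ B then
        5184 * (d : ℝ) ^ 2 * Real.log (M * T) * 2 ^ q.phase else 0 := by
    split_ifs
    · have h5 : (4 : ℝ) ^ q.phase = 2 ^ q.phase * 2 ^ q.phase := by
        rw [← mul_pow]; norm_num
      have h6 : (0 : ℝ) < 2 ^ q.phase := by positivity
      rw [div_mul_eq_mul_div, div_le_iff₀ h6]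
      rw [h5] at h1
      have h1' : (n : ℝ) ≤ 648 * (2 ^ q.phase * 2 ^ q.phase) * d ^ 2 * Real.log (M * T) := by
        rw [hn]; exact_mod_cast h1
      linarith
    · simp
  nlinarith

/-- A geometric sum is less than twice its last term, and the last term that counts is at most B. -/
lemma sum_pow_le (B : ℝ) (hB : 0 ≤ B) (n : ℕ) :
    ∑ l ∈ Finset.range n, (if (2 : ℝ) ^ l ≤ B then (2 : ℝ) ^ l else 0) ≤ 2 * B := by
  induction n with
  | zero => simpa using hB
  | succ n ih =>
    rw [Finset.sum_range_succ]
    split_ifs with h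
    · have h1 : ∑ l ∈ Finset.range n, (if (2 : ℝ) ^ l ≤ B then (2 : ℝ) ^ l else 0) ≤
          ∑ l ∈ Finset.range n, (2 : ℝ) ^ l := by
        refine Finset.sum_le_sum fun l _ => ?_
        split_ifs
        · exact le_rfl
        · positivity
      have h2 : ∑ l ∈ Finset.range n, (2 : ℝ) ^ l = 2 ^ n - 1 := by
        rw [geom_sum_eq (by norm_num)]; norm_num
      linarith
    · rwa [add_zero]

end Accounting

/-! ### The bounds -/

section Bounds

variable {d M T : ℕ} {R : DesignRule d} {D : Finset (Vec d)}

lemma one_le_log {T : ℕ} (hT : 2 < T) : 1 ≤ Real.log T := by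
  have : (3 : ℝ) ≤ T := by exact_mod_cast hT
  rw [Real.le_log_iff_exp_le (by linarith)]
  linarith [Real.exp_one_lt_d9]

lemma log_mul_le (hM : 1 ≤ M) (hMT : M < T) : Real.log (M * T) ≤ 2 * Real.log T := by
  have hM0 : (0 : ℝ) < M := by exact_mod_cast hM
  have hlt : (M : ℝ) ≤ T := by exact_mod_cast hMT.le
  rw [Real.log_mul hM0.ne' (by linarith)]
  linarith [Real.log_le_log hM0 hlt]

lemma log_add_two_le (hM : 1 ≤ M) (hMT : M < T) (hT : 2 < T) :
    ((Nat.log 4 (M * T) + 2 : ℕ) : ℝ) ≤ 4 * Real.log T := by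
  have h1 := Nat.pow_log_le_self 4 (x := M * T) (by positivity)
  have h2 : ((4 : ℝ) ^ Nat.log 4 (M * T)) ≤ M * T := by exact_mod_cast h1
  have h3 := Real.log_le_log (by positivity) h2
  rw [Real.log_pow] at h3
  have h4 : 1 ≤ Real.log 4 := by
    rw [Real.le_log_iff_exp_le (by norm_num)]
    linarith [Real.exp_one_lt_d9]
  have h5 := log_mul_le hM hMT
  have h6 := one_le_log hT
  have h7 : (0 : ℝ) ≤ Nat.log 4 (M * T) := Nat.cast_nonneg _
  push_cast
  nlinarith

variable (hD : D.Nonempty) {θ : Vec d} {N : ℕ → Fin M → Vec d → ℝ} {free : ℕ → Fin M → Vec d}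

lemma commCost_le (hD : D.Nonempty) (hd : 3 ≤ d) (hM : 1 ≤ M) (hMT : M < T) (hT : 2 < T) (hR : R.Valid M T) :
    ((delb M T R D).commCost θ N free T : ℝ) ≤
      576 * ((M * d + d * Real.log (Real.log d)) * Real.log T) := by
  have hT3 : 3 ≤ M * T := by nlinarith
  have hlen := len_pos (D := D) hR (by lia : 0 < d) (by lia : 1 < M * T)
  have hll := one_div_le_log_log hd
  have hd3 : (3 : ℝ) ≤ d := by exact_mod_cast hd
  have hM1 : (1 : ℝ) ≤ M := by exact_mod_cast hM
  set b : ℝ := 144 * (M * d + d * Real.log (Real.log d)) with hb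
  have hb0 : 0 ≤ b := by
    have : 0 ≤ Real.log (Real.log d) := by linarith
    positivity
  rw [commCost_eq hD hlen, Nat.cast_sum]
  refine (sum_cur_le hD hlen (fun q => (q.cost M T R : ℝ)) (fun _ => Nat.cast_nonneg _)
    (fun _ => b) (fun q => ?_) T).trans ?_
  · have h1 : ((∑ s ∈ Finset.range (q.len M T R), ({ q with step := s } : Cur D).cost M T R : ℕ) :
        ℝ) ≤ ((3 * ((q.design R).size + M) + M * d : ℕ) : ℝ) := by
      exact_mod_cast sum_cost_le q
    have h2 := (hR.isDesign q).size_le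
    push_cast at h1
    refine h1.trans ?_
    rw [hb]
    have h3 : (M : ℝ) * 3 ≤ M * d := by gcongr
    have h4 : 0 ≤ (M : ℝ) * d := by positivity
    linarith
  · simp only [max_eq_left hb0, Finset.sum_const, Finset.card_range, nsmul_eq_mul]
    have h1 : (((cur T R hD θ N T).phase + 1 : ℕ) : ℝ) ≤ 4 * Real.log T := by
      refine le_trans ?_ (log_add_two_le hM hMT hT)
      exact_mod_cast Nat.succ_le_succ (phase_le hD hR (by lia) hT3 le_rfl)
    calc (((cur T R hD θ N T).phase + 1 : ℕ) : ℝ) * b ≤ 4 * Real.log T * b := by gcongr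
      _ = _ := by rw [hb]; ring

lemma action_mem (hR : R.Valid M T) (hd : 0 < d) (hMT : 1 < M * T) (hfree : ∀ t i, free t i ∈ D)
    (t : ℕ) (i : Fin M) : (delb M T R D).action θ N free t i ∈ D := by
  have hD : D.Nonempty := ⟨_, hfree t i⟩
  rw [action_eq hD (len_pos hR hd hMT)]
  rcases h : (cur T R hD θ N t).target M T R i with _ | c
  · exact hfree t i
  · refine (cur T R hD θ N t).arm_mem hR (j := i)
      (k := (cur T R hD θ N t).step - (M - 1)) (c := c) ?_
    unfold Cur.target at h
    split_ifs at h
    exact h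

lemma regret_eq : (delb M T R D).regret D hD θ N free T =
    ∑ t ∈ Finset.range T, ∑ i : Fin M, gap hD θ ((delb M T R D).action θ N free t i) := rfl

lemma regret_nonneg (hR : R.Valid M T) (hd : 0 < d) (hMT : 1 < M * T)
    (hfree : ∀ t i, free t i ∈ D) : 0 ≤ (delb M T R D).regret D hD θ N free T :=
  Finset.sum_nonneg fun t _ => Finset.sum_nonneg fun i _ =>
    gap_nonneg hD (action_mem hR hd hMT hfree t i)

lemma regret_le_trivial (hR : R.Valid M T) (hd : 0 < d) (hMT : 1 < M * T)
    (hD1 : ∀ x ∈ D, ‖x‖ ≤ 1) (hθ : ‖θ‖ ≤ 1) (hfree : ∀ t i, free t i ∈ D) :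
    (delb M T R D).regret D hD θ N free T ≤ 2 * (M * T) := by
  rw [regret_eq]
  calc _ ≤ ∑ _t ∈ Finset.range T, ∑ _i : Fin M, (2 : ℝ) :=
        Finset.sum_le_sum fun t _ => Finset.sum_le_sum fun i _ =>
          gap_le_two hD hD1 hθ (action_mem hR hd hMT hfree t i)
    _ = 2 * (M * T) := by simp; ring

/-- The regret in a time step. -/
lemma sum_gap_le (hR : R.Valid M T) (hd : 0 < d) (hMT : 1 < M * T)
    (hD1 : ∀ x ∈ D, ‖x‖ ≤ 1) (hθ : ‖θ‖ ≤ 1) (hfree : ∀ t i, free t i ∈ D)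
    (hN : ¬ Failure T R hD θ N) {t : ℕ} (ht : t ≤ T) {B : ℝ} (hB : 0 < B) :
    ∑ i : Fin M, gap hD θ ((delb M T R D).action θ N free t i) ≤
      M * (8 / B) + (cur T R hD θ N t).loss M T R B := by
  have h1 : (M : ℝ) * (8 / B) = ∑ _i : Fin M, 8 / B := by simp
  rw [h1, Cur.loss, ← Finset.sum_add_distrib]
  refine Finset.sum_le_sum fun i _ => ?_
  have hB' : 0 < 8 / B := by positivity
  rcases h : (cur T R hD θ N t).target M T R i with _ | c
  · have := gap_le_two hD hD1 hθ (action_mem (θ := θ) (N := N) hR hd hMT hfree t i)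
    simp only [Option.elim_none]
    linarith
  · have hact : (delb M T R D).action θ N free t i = ((cur T R hD θ N t).design R).arm c := by
      rw [action_eq hD (len_pos hR hd hMT), h]
      rfl
    have hpull : (cur T R hD θ N t).pull M T R i
        ((cur T R hD θ N t).step - (M - 1)) = some c := by
      unfold Cur.target at h
      split_ifs at h
      exact h
    have hmem := (hR.isDesign (cur T R hD θ N t)).arm_mem c (Cur.pull_lt _ hpull)
    have hgap := (gap_le_of_not_failure hD hR hd hMT hD1 hθ hN ht).2 _ hmem
    rw [hact]
    refine hgap.trans ?_
    rw [one_div, inv_pow, ← div_eq_mul_inv]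
    simp only [Option.elim_some]
    -- In late phases, 2^l > B, the gap is below 8/B and is paid for by the uniform term instead of
    -- by `loss`.
    split_ifs with h2
    · linarith
    · rw [add_zero]
      push Not at h2
      gcongr

/-- With B = S/W the uniform term MT · 8/B and the geometric sum 10368 W² B are both multiples of SW
= d √(MT log(MT)). Replacing log(MT) by log T costs at most a factor 2, and 20752 = 2 (8 + 10368).
-/
lemma regret_le_of_not_failure (hd : 3 ≤ d) (hM : 1 ≤ M) (hMT : M < T) (hT : 2 < T)
    (hR : R.Valid M T) (hD1 : ∀ x ∈ D, ‖x‖ ≤ 1) (hθ : ‖θ‖ ≤ 1) (hfree : ∀ t i, free t i ∈ D)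
    (hN : ¬ Failure T R hD θ N) :
    (delb M T R D).regret D hD θ N free T ≤
      20752 * (d * √(M * T * Real.log T)) + 24 * ((M : ℝ) ^ 2 * Real.log T) := by
  have hT3 : 3 ≤ M * T := by nlinarith
  have hMT1 : 1 < M * T := by lia
  have hd0 : 0 < d := by lia
  have hd0' : (0 : ℝ) < d := by exact_mod_cast hd0
  have hlen := len_pos (D := D) hR hd0 hMT1
  have hX0 : (0 : ℝ) < M * T := by exact_mod_cast (by lia : 0 < M * T)
  have hL1 : 0 < Real.log (M * T) := Real.log_pos (by exact_mod_cast hMT1)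
  set S : ℝ := √(M * T) with hS
  set W : ℝ := d * √(Real.log (M * T)) with hW
  have hS0 : 0 < S := Real.sqrt_pos.2 hX0
  have hW0 : 0 < W := mul_pos hd0' (Real.sqrt_pos.2 hL1)
  have hSS : S ^ 2 = M * T := Real.sq_sqrt hX0.le
  have hWW : W ^ 2 = d ^ 2 * Real.log (M * T) := by rw [hW, mul_pow, Real.sq_sqrt hL1.le]
  set B : ℝ := S / W with hB
  have hB0 : 0 < B := div_pos hS0 hW0
  let bd : ℕ → ℝ := fun l => 6 * (M : ℝ) ^ 2 + if (2 : ℝ) ^ l ≤ B then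
    5184 * (d : ℝ) ^ 2 * Real.log (M * T) * 2 ^ l else 0
  have hbd0 : ∀ l, 0 ≤ bd l := by
    intro l
    simp only [bd]
    split_ifs <;> positivity
  have hsum : ∑ t ∈ Finset.range T, (cur T R hD θ N t).loss M T R B ≤
      24 * ((M : ℝ) ^ 2 * Real.log T) + 10368 * (W ^ 2 * B) := by
    refine (sum_cur_le hD hlen (fun q => q.loss M T R B) (fun q => q.loss_nonneg B) bd
      (fun q => sum_loss_le hR hd hT3 B q) T).trans ?_
    simp only [max_eq_left (hbd0 _)]
    calc ∑ l ∈ Finset.range ((cur T R hD θ N T).phase + 1), bd l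
        ≤ ∑ l ∈ Finset.range (Nat.log 4 (M * T) + 2), bd l :=
          Finset.sum_le_sum_of_subset_of_nonneg
            (Finset.range_subset_range.2 (Nat.succ_le_succ (phase_le hD hR hd0 hT3 le_rfl)))
            fun _ _ _ => hbd0 _
      _ = ((Nat.log 4 (M * T) + 2 : ℕ) : ℝ) * (6 * (M : ℝ) ^ 2) + 5184 * W ^ 2 *
          ∑ l ∈ Finset.range (Nat.log 4 (M * T) + 2),
            (if (2 : ℝ) ^ l ≤ B then (2 : ℝ) ^ l else 0) := by
          simp only [bd]
          rw [Finset.sum_add_distrib, Finset.sum_const, Finset.card_range, nsmul_eq_mul,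
            Finset.mul_sum, hWW]
          congr 1
          refine Finset.sum_congr rfl fun l _ => ?_
          split_ifs <;> ring
      _ ≤ 4 * Real.log T * (6 * (M : ℝ) ^ 2) + 5184 * W ^ 2 * (2 * B) := by
          gcongr
          · exact log_add_two_le hM hMT hT
          · exact sum_pow_le B hB0.le _
      _ = _ := by ring
  have hreg : (delb M T R D).regret D hD θ N free T ≤
      T * (M * (8 / B)) + (24 * ((M : ℝ) ^ 2 * Real.log T) + 10368 * (W ^ 2 * B)) := by
    rw [regret_eq]
    refine (Finset.sum_le_sum fun t ht => sum_gap_le hD hR hd0 hMT1 hD1 hθ hfree hN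
      (Finset.mem_range.1 ht).le hB0).trans ?_
    rw [Finset.sum_add_distrib]
    simp only [Finset.sum_const, Finset.card_range, nsmul_eq_mul]
    linarith
  have e1 : (T : ℝ) * (M * (8 / B)) = 8 * (S * W) := by
    have : (T : ℝ) * (M * (8 / B)) = (M * T) * (8 / B) := by ring
    rw [this, ← hSS, hB]
    field_simp
  have e2 : W ^ 2 * B = S * W := by
    rw [hB]; field_simp
  have e3 : S * W ≤ 2 * (d * √(M * T * Real.log T)) := by
    have h1 : S * W = d * √(M * T * Real.log (M * T)) := by
      rw [Real.sqrt_mul hX0.le, hS, hW]; ring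
    have h2 : √(M * T * Real.log (M * T)) ≤ 2 * √(M * T * Real.log T) := by
      rw [Real.sqrt_le_left (by positivity), mul_pow, Real.sq_sqrt (by
        have := one_le_log hT
        positivity)]
      have h3 := log_mul_le hM hMT
      have h4 := one_le_log hT
      nlinarith
    rw [h1]
    nlinarith
  rw [e1, e2] at hreg
  linarith

/-- If T ≤ M⁴, then log T and log M are comparable and the hypothesis applies. If T > M⁴, then with
y = log T / 4 both M and y are at most e^y, so the left side is at most 4 e^(4y) = 4T. -/
lemma pow_three_mul_log_le (hM : 1 ≤ M) (hT : 2 < T) (h : (M : ℝ) ^ 3 * Real.log M < T) :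
    (M : ℝ) ^ 3 * Real.log T ≤ 4 * T := by
  have hM0 : (0 : ℝ) < M := by exact_mod_cast hM
  have hT0 : (0 : ℝ) < T := by exact_mod_cast (by lia : 0 < T)
  by_cases hl : Real.log T ≤ 4 * Real.log M
  · have : (M : ℝ) ^ 3 * Real.log T ≤ M ^ 3 * (4 * Real.log M) := by gcongr
    linarith
  · push Not at hl
    set y := Real.log T / 4 with hy
    have h1 : (M : ℝ) ≤ Real.exp y := by
      rw [← Real.log_le_iff_le_exp hM0]
      linarith
    have h2 : y ≤ Real.exp y := by linarith [Real.add_one_le_exp y]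
    have h3 : Real.exp y ^ 4 = T := by
      rw [← Real.exp_nat_mul, hy]
      push_cast
      rw [mul_div_cancel₀ _ (by norm_num), Real.exp_log hT0]
    have h4 : 0 ≤ y := by have := one_le_log hT; positivity
    have h5 : Real.log T = 4 * y := by rw [hy]; ring
    calc (M : ℝ) ^ 3 * Real.log T = M ^ 3 * (4 * y) := by rw [h5]
      _ ≤ Real.exp y ^ 3 * (4 * Real.exp y) := by gcongr
      _ = 4 * Real.exp y ^ 4 := by ring
      _ = 4 * T := by rw [h3]

/-- The square of the left side is (M³ log T)(M log T), and the first factor is at most 4T. -/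
lemma sq_mul_log_le (hd : 1 ≤ d) (hM : 1 ≤ M) (hT : 2 < T)
    (h : (M : ℝ) ^ 3 * Real.log M < T) :
    (M : ℝ) ^ 2 * Real.log T ≤ 2 * (d * √(M * T * Real.log T)) := by
  have h1 := pow_three_mul_log_le hM hT h
  have hlog := one_le_log hT
  have hM0 : (0 : ℝ) < M := by exact_mod_cast hM
  have hd1 : (1 : ℝ) ≤ d := by exact_mod_cast hd
  have h2 : (M : ℝ) ^ 2 * Real.log T ≤ √(4 * (M * T * Real.log T)) := by
    apply Real.le_sqrt_of_sq_le
    have : ((M : ℝ) ^ 2 * Real.log T) ^ 2 = (M ^ 3 * Real.log T) * (M * Real.log T) := by ring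
    rw [this]
    calc (M : ℝ) ^ 3 * Real.log T * (M * Real.log T) ≤ 4 * T * (M * Real.log T) := by gcongr
      _ = _ := by ring
  have h3 : √(4 * (M * T * Real.log T)) = 2 * √(M * T * Real.log T) := by
    rw [Real.sqrt_mul (by norm_num), show (4 : ℝ) = 2 ^ 2 by norm_num,
      Real.sqrt_sq (by norm_num)]
  have h4 : √(M * T * Real.log T) ≤ d * √(M * T * Real.log T) :=
    le_mul_of_one_le_left (Real.sqrt_nonneg _) hd1
  linarith

end Bounds

/-! ### Measurability and expectations -/

section Expectation

variable {d M T : ℕ} {R : DesignRule d} {D : Finset (Vec d)} (hD : D.Nonempty) {θ : Vec d}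
variable {Ω : Type*} [MeasurableSpace Ω] {μ : Measure Ω}
  {η : Ω → ℕ → Fin M → Vec d → ℝ} {free : Ω → ℕ → Fin M → Vec d}

lemma measurable_cur_noise (hR : R.Valid M T) (hd : 0 < d) (hMT : 1 < M * T)
    (hmeas : ∀ t i x, Measurable fun ω => η ω t i x) (t : ℕ) :
    Measurable fun ω => cur T R hD θ (η ω) t :=
  (measurable_cur hD θ hR hd hMT t).comp (measurable_noise_map hmeas)

/-- An action is a function of the common state, which takes countably many values, and of the
arbitrary arm, so joint measurability can be checked state by state. The arbitrary arms may depend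
on the noise in any measurable way. -/
lemma measurable_regret (hR : R.Valid M T) (hd : 0 < d) (hMT : 1 < M * T)
    (hmeas : ∀ t i x, Measurable fun ω => η ω t i x)
    (hfree : ∀ t i, Measurable fun ω => free ω t i) :
    Measurable fun ω => (delb M T R D).regret D hD θ (η ω) (free ω) T := by
  unfold P2PProtocol.regret
  refine Finset.measurable_sum _ fun t _ => Finset.measurable_sum _ fun i _ =>
    measurable_const.sub ?_
  let G : Vec d × Cur D → ℝ := fun p =>
    inner ℝ (((p.2.target M T R i).map (p.2.design R).arm).getD p.1) θ
  have hG : Measurable G := by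
    refine measurable_from_prod_countable_left fun q => ?_
    simp only [G]
    cases q.target M T R i with
    | none => exact measurable_id.inner measurable_const
    | some c =>
      simp only [Option.map_some, Option.getD_some]
      exact measurable_const
  have hact : ∀ ω, inner ℝ ((delb M T R D).action θ (η ω) (free ω) t i) θ =
      G (free ω t i, cur T R hD θ (η ω) t) := fun ω => by
    rw [action_eq hD (len_pos hR hd hMT)]
  simp only [hact]
  exact hG.comp ((hfree t i).prodMk (measurable_cur_noise hD hR hd hMT hmeas t))

lemma measurable_commCost (hD : D.Nonempty) (hR : R.Valid M T) (hd : 0 < d) (hMT : 1 < M * T)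
    (hmeas : ∀ t i x, Measurable fun ω => η ω t i x) :
    Measurable fun ω => ((delb M T R D).commCost θ (η ω) (free ω) T : ℝ) := by
  simp only [commCost_eq hD (len_pos hR hd hMT), Nat.cast_sum]
  refine Finset.measurable_sum _ fun t _ => ?_
  exact (Measurable.of_discrete (f := fun q : Cur D => (q.cost M T R : ℝ))).comp
    (measurable_cur_noise hD hR hd hMT hmeas t)

lemma integrable_regret [IsFiniteMeasure μ] (hR : R.Valid M T) (hd : 0 < d) (hMT : 1 < M * T)
    (hD1 : ∀ x ∈ D, ‖x‖ ≤ 1) (hθ : ‖θ‖ ≤ 1)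
    (hmeas : ∀ t i x, Measurable fun ω => η ω t i x)
    (hfree : ∀ t i, Measurable fun ω => free ω t i) (hfreeD : ∀ ω t i, free ω t i ∈ D) :
    Integrable (fun ω => (delb M T R D).regret D hD θ (η ω) (free ω) T) μ := by
  refine Integrable.of_bound (measurable_regret hD hR hd hMT hmeas hfree).aestronglyMeasurable
    (2 * (M * T)) (ae_of_all _ fun ω => ?_)
  rw [Real.norm_eq_abs, abs_of_nonneg (regret_nonneg hD hR hd hMT (hfreeD ω))]
  exact regret_le_trivial hD hR hd hMT hD1 hθ (hfreeD ω)

lemma integral_regret_le [IsProbabilityMeasure μ] (hd : 3 ≤ d) (hM : 1 ≤ M) (hMT : M < T)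
    (hT : 2 < T) (hR : R.Valid M T) (hD1 : ∀ x ∈ D, ‖x‖ ≤ 1) (hθ : ‖θ‖ ≤ 1)
    (hmeas : ∀ t i x, Measurable fun ω => η ω t i x)
    (hind : iIndepFun (fun (p : ℕ × Fin M) (ω : Ω) => η ω p.1 p.2) μ)
    (hbd : ∀ ω t i, ∀ x ∈ D, η ω t i x ∈ Set.Icc (-1 : ℝ) 1)
    (hmean : ∀ t i, ∀ x ∈ D, ∫ ω, η ω t i x ∂μ = 0)
    (hfree : ∀ t i, Measurable fun ω => free ω t i) (hfreeD : ∀ ω t i, free ω t i ∈ D) :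
    ∫ ω, (delb M T R D).regret D hD θ (η ω) (free ω) T ∂μ ≤
      20760 * (d * √(M * T * Real.log T)) + 24 * ((M : ℝ) ^ 2 * Real.log T) := by
  have hT3 : 3 ≤ M * T := by nlinarith
  have hMT1 : 1 < M * T := by lia
  have hd0 : 0 < d := by lia
  have hX : (1 : ℝ) ≤ M * T := by exact_mod_cast hMT1.le
  have hlog := one_le_log hT
  set K : ℝ := 20752 * (d * √(M * T * Real.log T)) + 24 * ((M : ℝ) ^ 2 * Real.log T) with hK
  have hK0 : 0 ≤ K := by positivity
  -- A measurable hull of the same measure makes measurability of the failure event itself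
  -- unnecessary.
  set F := toMeasurable μ {ω | Failure T R hD θ (η ω)} with hF
  have hFm : MeasurableSet F := measurableSet_toMeasurable _ _
  have hμF : μ.real F ≤ 4 / (M * T) := by
    rw [hF, measureReal_def, measure_toMeasurable]
    exact measure_failure_le hR hd0 hT3 hmeas hind hbd hmean hD θ
  have hle : ∀ ω, (delb M T R D).regret D hD θ (η ω) (free ω) T ≤
      K + F.indicator (fun _ => 2 * (M * T : ℝ)) ω := by
    intro ω
    by_cases hω : ω ∈ F
    · rw [Set.indicator_of_mem hω]
      linarith [regret_le_trivial hD (N := η ω) hR hd0 hMT1 hD1 hθ (hfreeD ω)]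
    · rw [Set.indicator_of_notMem hω, add_zero]
      exact regret_le_of_not_failure hD hd hM hMT hT hR hD1 hθ (hfreeD ω)
        fun h => hω (subset_toMeasurable _ _ h)
  have hone : 1 ≤ (d : ℝ) * √(M * T * Real.log T) := by
    have h1 : (1 : ℝ) ≤ √(M * T * Real.log T) := by
      rw [Real.one_le_sqrt]
      nlinarith
    have h2 : (1 : ℝ) ≤ d := by exact_mod_cast hd0
    nlinarith
  have hint : Integrable (F.indicator fun _ => 2 * (M * T : ℝ)) μ :=
    (integrable_const _).indicator hFm
  calc ∫ ω, (delb M T R D).regret D hD θ (η ω) (free ω) T ∂μ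
      ≤ ∫ ω, (K + F.indicator (fun _ => 2 * (M * T : ℝ)) ω) ∂μ :=
        integral_mono (integrable_regret hD hR hd0 hMT1 hD1 hθ hmeas hfree hfreeD)
          ((integrable_const _).add hint) hle
    _ = K + μ.real F * (2 * (M * T)) := by
        rw [integral_add (integrable_const _) hint, integral_indicator_const _ hFm]
        simp
    -- A failure adds at most 8 to the expected regret, which is absorbed into the first term since
    -- d √(MT log T) ≥ 1.
    _ ≤ K + 4 / (M * T) * (2 * (M * T)) := by gcongr
    _ = K + 8 := by field_simp; norm_num
    _ ≤ _ := by rw [hK]; linarith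

end Expectation

end DELB

/-! ### The main theorem -/

theorem theorem8 :
    ∃ C : ℝ, 0 < C ∧ ∀ d M T : ℕ, 3 ≤ d → 1 ≤ M → M < T → 2 < T →
      (∃ R : DELB.DesignRule d, R.Valid M T) ∧
      ∀ (R : DELB.DesignRule d), R.Valid M T →
      ∀ (D : Finset (DELB.Vec d)) (hD : D.Nonempty), (∀ x ∈ D, ‖x‖ ≤ 1) →
      ∀ θ : DELB.Vec d, ‖θ‖ ≤ 1 →
      ∀ {Ω : Type*} [MeasurableSpace Ω] (μ : Measure Ω) [IsProbabilityMeasure μ]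
        (η : Ω → ℕ → Fin M → DELB.Vec d → ℝ) (free : Ω → ℕ → Fin M → DELB.Vec d),
        (∀ t i x, Measurable fun ω => η ω t i x) →
        iIndepFun (fun (p : ℕ × Fin M) (ω : Ω) => η ω p.1 p.2) μ →
        (∀ ω t i, ∀ x ∈ D, η ω t i x ∈ Set.Icc (-1 : ℝ) 1) →
        (∀ t i, ∀ x ∈ D, ∫ ω, η ω t i x ∂μ = 0) →
        (∀ t i, Measurable fun ω => free ω t i) →
        (∀ ω t i, free ω t i ∈ D) →
        Integrable (fun ω => (DELB.delb M T R D).regret D hD θ (η ω) (free ω) T) μ ∧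
        ∫ ω, (DELB.delb M T R D).regret D hD θ (η ω) (free ω) T ∂μ
          ≤ C * (d * √(M * T * Real.log T) + (M : ℝ) ^ 2 * Real.log T) ∧
        Integrable (fun ω => ((DELB.delb M T R D).commCost θ (η ω) (free ω) T : ℝ)) μ ∧
        ∫ ω, ((DELB.delb M T R D).commCost θ (η ω) (free ω) T : ℝ) ∂μ
          ≤ C * ((M * d + d * Real.log (Real.log d)) * Real.log T) ∧
        ((M : ℝ) ^ 3 * Real.log M < T →
          ∫ ω, (DELB.delb M T R D).regret D hD θ (η ω) (free ω) T ∂μ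
            ≤ C * (d * √(M * T * Real.log T))) := by
  -- The last claim needs the largest constant: 20808 = 20760 + 24 · 2, the factor 2 coming from
  -- `sq_mul_log_le`.
  refine ⟨20808, by norm_num, fun d M T hd hM hMT hT => ⟨?_, ?_⟩⟩
  · exact DELB.exists_valid_rule hd (by nlinarith)
  · intro R hR D hD hD1 θ hθ Ω _ μ _ η free hmeas hind hbd hmean hfree hfreeD
    have hd0 : 0 < d := by lia
    have hMT1 : 1 < M * T := by nlinarith
    have hlog := DELB.one_le_log hT
    have hll := DELB.one_div_le_log_log hd
    have hcost : ∀ ω, ((DELB.delb M T R D).commCost θ (η ω) (free ω) T : ℝ) ≤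
        576 * ((M * d + d * Real.log (Real.log d)) * Real.log T) :=
      fun ω => DELB.commCost_le hD hd hM hMT hT hR
    have hcint : Integrable
        (fun ω => ((DELB.delb M T R D).commCost θ (η ω) (free ω) T : ℝ)) μ := by
      refine Integrable.of_bound
        (DELB.measurable_commCost hD hR hd0 hMT1 hmeas).aestronglyMeasurable
        (576 * ((M * d + d * Real.log (Real.log d)) * Real.log T)) (ae_of_all _ fun ω => ?_)
      rw [Real.norm_of_nonneg (Nat.cast_nonneg _)]
      exact hcost ω
    have hreg := DELB.integral_regret_le hD hd hM hMT hT hR hD1 hθ hmeas hind hbd hmean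
      hfree hfreeD
    have ha : 0 ≤ (d : ℝ) * √(M * T * Real.log T) := by positivity
    have hb : 0 ≤ (M : ℝ) ^ 2 * Real.log T := by positivity
    have hc : 0 ≤ ((M : ℝ) * d + d * Real.log (Real.log d)) * Real.log T := by
      have : 0 ≤ Real.log (Real.log d) := by linarith
      positivity
    refine ⟨DELB.integrable_regret hD hR hd0 hMT1 hD1 hθ hmeas hfree hfreeD, by linarith,
      hcint, ?_, fun h => ?_⟩
    · calc ∫ ω, ((DELB.delb M T R D).commCost θ (η ω) (free ω) T : ℝ) ∂μ
          ≤ ∫ _ω, 576 * ((M * d + d * Real.log (Real.log d)) * Real.log T) ∂μ :=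
            integral_mono hcint (integrable_const _) hcost
        _ = 576 * ((M * d + d * Real.log (Real.log d)) * Real.log T) := by simp
        _ ≤ _ := by linarith
    · have := DELB.sq_mul_log_le (d := d) hd0 hM hT h
      linarith
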